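/- Let $L\ge 1$ be the number of downloading threads and let $\mu>0$. A sequence of $N$ read requests ($N$ finite or infinite) is given by deterministic parameters $(a_i,k_i,n_i)$, where $a_i$ is the arrival time of request $i$, $0=a_1\le a_2\le\cdots$, and the file of request $i$ is stored as $n_i$ coded chunks of an $(n_i,k_i)$ MDS code, $1\le k_i\le n_i$, so that request $i$ is completed at the first time $c_i$ at which $k_i$ of its chunks have been downloaded. Put $d_i=n_i-k_i+1$ and $d_{\min}=\min_i d_i$. The downloading times of the chunks are i.i.d. exponential random variables with mean $1/\mu$. At any time each thread may serve one available (not yet downloaded) chunk of an arrived, unfinished request, each chunk being served by at most one thread; preemption is allowed, that is, the set of chunks under service may be changed at any time without delay, and an interrupted download is later resumed from the interrupted point. An online policy chooses at each time the set of chunks under service from what is known at that time: the parameters of the requests that have arrived so far, the times and identities of the chunk downloads completed so far, the current time, and possibly an independent random seed. In particular, it knows neither the number and the parameters of future requests nor the downloading times of chunks not yet completed. The average flow time of a policy $\pi$ is $$\overline D_\pi=\frac1N\sum_{i=1}^N\bigl(\mathbb E\{c_{i,\pi}\}-a_i\bigr)$$ for finite $N$. For infinite $N$ it is the $\limsup$,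 as $N\to\infty$, of the average flow times for the request sequences that consist of the first $N$ requests. Preemptive SERPT-R is the following policy: at any time, the threads are assigned to the available chunks of the unfinished request with the fewest remaining chunks (chunks that still need to be downloaded to complete the request); when all of these are under service, the next threads are assigned to the available chunks of the unfinished request with the second fewest remaining chunks; and so on, until all $L$ threads are occupied or all available chunks of the unfinished requests are under service. Ties are broken arbitrarily. Theorem. Online policies of this kind exist, and every preemptive SERPT-R policy is delay-optimal under high redundancy: for any request sequence $N$, $(a_i,k_i,n_i)_{i=1}^N$ as above with $d_{\min}\ge L$, and for every online policy $\pi$, $$\overline D_{\text{SERPT-R}}\le\overline D_\pi .$$ -/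

import Mathlib

open MeasureTheory ProbabilityTheory Filter
open scoped ENNReal

noncomputable section

namespace CloudStorage

/-- A read request: its arrival time `a` and the parameters `(n, k)` of the MDS code of its file
(any `k` of the `n` coded chunks suffice to restore the file). -/
structure Request where
  arrival : ℝ
  k : ℕ
  n : ℕ

/-- The Hamming distance `d = n - k + 1` of the MDS code of a request. -/
def Request.dist (r : Request) : ℕ := r.n - r.k + 1

/-- Admissible parameters `N` and `(a_i, k_i, n_i)`, `i < N`, where `N` is finite or infinite and
requests are numbered from `0`: `0 = a_0 ≤ a_1 ≤ ⋯` and `1 ≤ k_i ≤ n_i`. -/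
structure IsRequestSequence (req : ℕ → Request) (N : ℕ∞) : Prop where
  arrival_zero : (req 0).arrival = 0
  arrival_mono : ∀ i j : ℕ, i ≤ j → (j : ℕ∞) < N → (req i).arrival ≤ (req j).arrival
  one_le_k : ∀ i : ℕ, (i : ℕ∞) < N → 1 ≤ (req i).k
  k_le_n : ∀ i : ℕ, (i : ℕ∞) < N → (req i).k ≤ (req i).n

/-- The minimum code distance of the first `N` requests (`N` finite or infinite). -/
def minDist (req : ℕ → Request) (N : ℕ∞) : ℕ∞ :=
  ⨅ (i : ℕ) (_ : (i : ℕ∞) < N), ((req i).dist : ℕ∞)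

/-- `(i, j)` is the `j`-th coded chunk of the file of request `i`. -/
abbrev Chunk := ℕ × ℕ

/-- The record of all completed chunk downloads, oldest first: the instants at which downloads were
completed, each with the set of chunks completed at that instant. -/
abbrev DownloadLog := List (ℝ × Finset Chunk)

/-- The chunks whose download is recorded in a log. -/
def downloaded (l : DownloadLog) : Finset Chunk :=
  l.foldr (fun e s => e.2 ∪ s) ∅

/-- The number of downloaded chunks of request `i`. -/
def numDownloaded (l : DownloadLog) (i : ℕ) : ℕ :=
  ((downloaded l).filter (fun c => c.1 = i)).card

/-- What the decision-maker can observe at a given time: the requests that have arrived so far, with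
their parameters and in order of arrival, the chunk downloads completed so far, and the clock. -/
structure Observation where
  arrived : List Request
  log : DownloadLog
  time : ℝ

/-- Request `i` has arrived and fewer than `k_i` of its chunks have been downloaded. -/
def Observation.Unfinished (o : Observation) (i : ℕ) : Prop :=
  ∃ r : Request, o.arrived[i]? = some r ∧ numDownloaded o.log i < r.k

/-- The number of chunks that still need to be downloaded to complete request `i`. -/
def Observation.remaining (o : Observation) (i : ℕ) : ℕ :=
  match o.arrived[i]? with
  | some r => r.k - numDownloaded o.log i
  | none => 0

/-- The available chunks of request `i`: those that have not been downloaded. -/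
def Observation.available (o : Observation) (i : ℕ) : Finset Chunk :=
  match o.arrived[i]? with
  | some r => ({i} ×ˢ Finset.range r.n) \ downloaded o.log
  | none => ∅

/-- An online scheduling policy for `L` threads, preemption being allowed. At every time the policy
selects, from what is observable at that time and from a random seed that it may use to randomize,
the set of chunks that are under service. The `L` threads are identical and each serves one chunk,
so that at most `L` chunks are under service; these are available chunks of unfinished requests
(the service of the other chunks of a request is terminated when the request is completed). The set
may change at any time. -/
structure OnlinePolicy (L : ℕ) where
  serve : unitInterval → Observation → Finset Chunk
  card_le : ∀ u o, (serve u o).card ≤ L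
  feasible : ∀ u o, ∀ c ∈ serve u o, o.Unfinished c.1 ∧ c ∈ o.available c.1
  measurable_serve : ∀ (arr : List Request) (cs : List (Finset Chunk)) (A : Finset Chunk),
    MeasurableSet {p : unitInterval × (Fin cs.length → ℝ) × ℝ |
      serve p.1 ⟨arr, List.ofFn (fun j => (p.2.1 j, cs.get j)), p.2.2⟩ = A}

/-- Preemptive SERPT-R (ties between requests, and between chunks of one request, are broken
arbitrarily): at any time, the threads are assigned to the available chunks of the unfinished
request with the fewest remaining chunks; if all of these are under service, the next threads are
assigned to the request with the second fewest remaining chunks; and so on, until all `L` threads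
are occupied or all available chunks of the unfinished requests are under service. -/
structure OnlinePolicy.IsSERPTR {L : ℕ} (σ : OnlinePolicy L) : Prop where
  /-- No thread is idle unless all available chunks of unfinished requests are under service. -/
  no_idle : ∀ u o, (σ.serve u o).card < L →
    ∀ i, o.Unfinished i → o.available i ⊆ σ.serve u o
  /-- A request is served only if the available chunks of every unfinished request with fewer
  remaining chunks are all under service. -/
  priority : ∀ u o, ∀ c ∈ σ.serve u o, ∀ i, o.Unfinished i →
    o.remaining i < o.remaining c.1 → o.available i ⊆ σ.serve u o
  /-- Requests with equally many remaining chunks are served one after the other: if two of them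
  are served, then all available chunks of at least one of them are under service. -/
  one_by_one : ∀ u o, ∀ c ∈ σ.serve u o, ∀ c' ∈ σ.serve u o, c.1 ≠ c'.1 →
    o.remaining c.1 = o.remaining c'.1 →
      o.available c.1 ⊆ σ.serve u o ∨ o.available c'.1 ⊆ σ.serve u o

section Dynamics

open Classical in
/-- The requests, among the first `N`, that have arrived by time `t`. -/
def arrivedBy (req : ℕ → Request) (N : ℕ) (t : ℝ) : List Request :=
  ((List.range N).map req).filter (fun r => r.arrival ≤ t)

/-- All chunks of the first `N` requests. -/
def allChunks (req : ℕ → Request) (N : ℕ) : Finset Chunk :=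
  (Finset.range N).biUnion (fun i => {i} ×ˢ Finset.range (req i).n)

/-- State of the system just after some chunk completion (or initially): the time, the log of
completed downloads, and the remaining downloading time of every chunk. -/
structure SystemState where
  time : ℝ
  log : DownloadLog
  rem : Chunk → ℝ

variable {L : ℕ} (π : OnlinePolicy L) (req : ℕ → Request) (N : ℕ) (u : unitInterval)

/-- The service time that chunk `c` receives between the time of state `s` and time `t`, if no
download is completed in between. -/
def serviceTime (s : SystemState) (c : Chunk) (t : ℝ) : ℝ :=
  (volume (Set.Ioc s.time t ∩ {v : ℝ | c ∈ π.serve u ⟨arrivedBy req N v, s.log, v⟩})).toReal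

/-- The times, not before that of state `s`, by which the service received since then covers the
remaining downloading time of some chunk. -/
def completionInstants (s : SystemState) : Set ℝ :=
  {t | s.time ≤ t ∧ ∃ c ∈ allChunks req N \ downloaded s.log, s.rem c ≤ serviceTime π req N u s c t}

open Classical in
/-- Run the system until the next completion of a chunk download. An interrupted download resumes
from the interrupted point. If no download is ever completed any more, the state is kept. -/
def nextState (s : SystemState) : SystemState :=
  if (completionInstants π req N u s).Nonempty then
    let t := sInf (completionInstants π req N u s)
    { time := t
      log := s.log ++ [(t, (allChunks req N \ downloaded s.log).filter
        (fun c => s.rem c ≤ serviceTime π req N u s c t))]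
      rem := fun c => s.rem c - serviceTime π req N u s c t }
  else s

/-- The state after the `m`-th completion instant, when the system starts at time `0` and chunk `c`
has downloading time `x c`. -/
def stateAfter (x : Chunk → ℝ) (m : ℕ) : SystemState :=
  (nextState π req N u)^[m] { time := 0, log := [], rem := x }

/-- The completion time of request `i`: the first time at which `k_i` of its chunks have been
downloaded (`∞` if this never happens). -/
def completionTime (x : Chunk → ℝ) (i : ℕ) : ℝ≥0∞ :=
  ⨅ (m : ℕ) (_ : (req i).k ≤ numDownloaded (stateAfter π req N u x m).log i),
    ENNReal.ofReal (stateAfter π req N u x m).time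

end Dynamics

/-- The law of the seed and of the chunk downloading times: the latter are i.i.d. exponential with
mean `1 / μ`, and the seed is uniform on `[0, 1]` and independent of them. -/
def randomness (μ : ℝ) : Measure (unitInterval × (Chunk → ℝ)) :=
  (volume : Measure unitInterval).prod (Measure.infinitePi (fun _ : Chunk => expMeasure μ))

/-- The average flow time `(1 / N) ∑ (E c_i - a_i)` when exactly the first `N` requests arrive. -/
def averageFlowTimeFin {L : ℕ} (π : OnlinePolicy L) (μ : ℝ) (req : ℕ → Request) (N : ℕ) : EReal :=
  ((1 / N : ℝ) : EReal) * ∑ i ∈ Finset.range N,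
    (((∫⁻ ω, completionTime π req N ω.1 ω.2 i ∂(randomness μ) : ℝ≥0∞) : EReal)
      - ((req i).arrival : EReal))

open Classical in
/-- The average flow time for `N` requests, `N` finite or infinite; for infinite `N` it is the limit
superior, as `N` tends to infinity, of the average flow time for the first `N` requests. -/
def averageFlowTime {L : ℕ} (π : OnlinePolicy L) (μ : ℝ) (req : ℕ → Request) (N : ℕ∞) : EReal :=
  if N = ⊤ then limsup (fun n : ℕ => averageFlowTimeFin π μ req n) atTop
  else averageFlowTimeFin π μ req N.toNat

end CloudStorage

end

/-! The total completion time is the integral over K > 0 of the number of requests incomplete at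
time K, so it suffices to minimize, for each fixed K, the expected number of late requests. The
comparison holds for every pair of seeds, so randomization gives no advantage.

Between two completions the log is fixed, so for a fixed seed the set under service is a
deterministic function of time. Let idle threads serve a fictitious idle chunk. Under every policy
the total service rate is then exactly L. Since exponential times are memoryless, the next event (a
completion, possibly of the idle chunk) occurs after an exponential time of rate μL whatever the
policy does. The policy only influences which chunk completes, and the residual times of the others
are fresh. This is `lintegral_eq_of_firstEvent`, applied in `expectedLate_eq`.

High redundancy enters through `le_card_available`: every unfinished request has at least L
available chunks. Hence SERPT-R is idle only if all arrived requests are complete, and otherwise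
each chunk it serves belongs to a request with the fewest remaining chunks. An event thus lowers a
smallest positive entry of its vector of remaining numbers, while another policy lowers some entry
or none.

The invariant is weak supermajorization, `Dominated`. It survives such a pair of events
(`Dominated.decrease_both`) and the arrival of requests (`Dominated.extend`), and it bounds the
number of positive entries, that is, of incomplete requests (`Dominated.card_pos_le`). Since the
event rates agree, the two recursions for the expected number of late requests can be compared event
by event (`expectedLate_le_add`); truncation after n events costs an error that tends to 0. -/

namespace CloudStorage

/-! ### Weak supermajorization of vectors of remaining chunk numbers -/

/-- For every set of discarded entries of `r'` one can discard at most as many entries of `r` such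
that the rest of `r` has at most the sum of the rest of `r'` (weak supermajorization). -/
def Dominated (I : Finset ℕ) (r r' : ℕ → ℕ) : Prop :=
  ∀ T' ⊆ I, ∃ T ⊆ I, T.card ≤ T'.card ∧ ∑ i ∈ I \ T, r i ≤ ∑ i ∈ I \ T', r' i

lemma Dominated.refl (I : Finset ℕ) (r : ℕ → ℕ) : Dominated I r r :=
  fun T' h => ⟨T', h, le_rfl, le_rfl⟩

/-- Inside `I` the discards come from the hypothesis; outside `I` the same entries are discarded on
both sides. This covers arrivals: the entries of newly arrived requests still agree in both runs. -/
lemma Dominated.extend {I J : Finset ℕ} {r r' : ℕ → ℕ} (h : Dominated I r r') (hIJ : I ⊆ J)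
    (heq : ∀ i ∈ J, i ∉ I → r i = r' i) : Dominated J r r' := by
  intro T' hT'
  obtain ⟨T, hT, hc, hs⟩ := h (T' ∩ I) Finset.inter_subset_right
  have key : ∀ (V : Finset ℕ) (q : ℕ → ℕ),
      ∑ i ∈ J \ V, q i = ∑ i ∈ I \ (V ∩ I), q i + ∑ i ∈ (J \ I) \ V, q i := by
    intro V q
    rw [← Finset.sum_union]
    · congr 1
      ext i
      have := @hIJ i
      simp only [Finset.mem_sdiff, Finset.mem_union, Finset.mem_inter]
      tauto
    · rw [Finset.disjoint_left]
      intro i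
      simp only [Finset.mem_sdiff]
      tauto
  refine ⟨T ∪ (T' \ I), ?_, ?_, ?_⟩
  · exact Finset.union_subset (hT.trans hIJ) (Finset.sdiff_subset.trans hT')
  · calc (T ∪ (T' \ I)).card ≤ T.card + (T' \ I).card := Finset.card_union_le _ _
      _ ≤ (T' ∩ I).card + (T' \ I).card := by gcongr
      _ = T'.card := Finset.card_inter_add_card_sdiff _ _
  · rw [key, key T']
    have e1 : (T ∪ T' \ I) ∩ I = T := by
      ext i
      have := @hT i
      simp only [Finset.mem_sdiff, Finset.mem_union, Finset.mem_inter]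
      tauto
    have e2 : (J \ I) \ (T ∪ T' \ I) = (J \ I) \ T' := by
      ext i
      have := @hT i
      simp only [Finset.mem_sdiff, Finset.mem_union]
      tauto
    rw [e1, e2]
    refine add_le_add hs (Finset.sum_le_sum fun i hi => ?_)
    simp only [Finset.mem_sdiff] at hi
    exact (heq i hi.1.1 hi.1.2).le

lemma Dominated.of_zero {I : Finset ℕ} {r : ℕ → ℕ} (r' : ℕ → ℕ) (h : ∀ i ∈ I, r i = 0) :
    Dominated I r r' := by
  intro T' _
  refine ⟨∅, by simp, by simp, ?_⟩
  rw [Finset.sum_eq_zero (fun i hi => h i (Finset.mem_sdiff.1 hi).1)]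
  exact Nat.zero_le _

/-- Discarding all positive entries of `r'` leaves sum zero, so the matching discard set for `r`
must contain all positive entries of `r`. -/
lemma Dominated.card_pos_le {I : Finset ℕ} {r r' : ℕ → ℕ} (h : Dominated I r r') :
    (I.filter (fun i => 0 < r i)).card ≤ (I.filter (fun i => 0 < r' i)).card := by
  obtain ⟨T, _, hc, hs⟩ := h (I.filter (fun i => 0 < r' i)) (Finset.filter_subset _ _)
  have h0 : ∑ i ∈ I \ I.filter (fun i => 0 < r' i), r' i = 0 := by
    refine Finset.sum_eq_zero fun i hi => ?_
    simp only [Finset.mem_sdiff, Finset.mem_filter, not_and, not_lt, Nat.le_zero] at hi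
    exact hi.2 hi.1
  rw [h0, Nat.le_zero, Finset.sum_eq_zero_iff] at hs
  refine le_trans (Finset.card_le_card fun i hi => ?_) hc
  rw [Finset.mem_filter] at hi
  by_contra hT
  have := hs i (Finset.mem_sdiff.2 ⟨hi.1, hT⟩)
  omega

lemma Dominated.decrease_left {I : Finset ℕ} {r r' q : ℕ → ℕ} (h : Dominated I r r')
    (hq : ∀ i, q i ≤ r i) : Dominated I q r' := by
  intro T' hT'
  obtain ⟨T, hT, hc, hs⟩ := h T' hT'
  exact ⟨T, hT, hc, (Finset.sum_le_sum fun i _ => hq i).trans hs⟩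

lemma sum_sdiff_update_pred {I T : Finset ℕ} {r : ℕ → ℕ} {i : ℕ} (hi : i ∈ I) (hT : i ∉ T)
    (hpos : 0 < r i) :
    ∑ l ∈ I \ T, Function.update r i (r i - 1) l + 1 = ∑ l ∈ I \ T, r l := by
  have hm : i ∈ I \ T := Finset.mem_sdiff.2 ⟨hi, hT⟩
  rw [← Finset.add_sum_erase _ _ hm, ← Finset.add_sum_erase _ r hm, Function.update_self]
  rw [Finset.sum_congr rfl (g := fun l => r l)]
  · omega
  · intro l hl
    rw [Function.update_of_ne (Finset.ne_of_mem_erase hl)]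

/-- Serving the smallest positive entry keeps the domination, whatever entry of the dominating
vector is served. -/
lemma Dominated.decrease_both {I : Finset ℕ} {r r' : ℕ → ℕ} (h : Dominated I r r') {i i' : ℕ}
    (hi : i ∈ I) (hpos : 0 < r i) (hmin : ∀ l ∈ I, 0 < r l → r i ≤ r l)
    (hi' : i' ∈ I) (hpos' : 0 < r' i') :
    Dominated I (Function.update r i (r i - 1)) (Function.update r' i' (r' i' - 1)) := by
  intro T' hT'
  obtain ⟨T, hT, hc, hs⟩ := h T' hT'
  have hle : ∀ l, Function.update r i (r i - 1) l ≤ r l := by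
    intro l
    by_cases hl : l = i
    · subst hl; simp
    · rw [Function.update_of_ne hl]
  -- If the served entry `i'` is discarded, the right sum does not change and the old `T` works.
  -- Otherwise the right sum drops by one and the left sum has to follow.
  by_cases hm' : i' ∈ T'
  · refine ⟨T, hT, hc, ((Finset.sum_le_sum fun l _ => hle l).trans hs).trans (le_of_eq ?_)⟩
    refine Finset.sum_congr rfl fun l hl => ?_
    rw [Function.update_of_ne]
    rintro rfl
    exact (Finset.mem_sdiff.1 hl).2 hm'
  have h1 := sum_sdiff_update_pred hi' hm' hpos'
  by_cases hm : i ∈ T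
  · by_cases hex : ∃ l ∈ I \ T, 0 < r l
    · obtain ⟨l, hl, hlpos⟩ := hex
      have hlI := (Finset.mem_sdiff.1 hl).1
      have hlT := (Finset.mem_sdiff.1 hl).2
      have hil : i ≠ l := by rintro rfl; exact hlT hm
      -- The discarded entry `i` is exchanged for a positive entry `l` that was kept. As `r i ≤ r
      -- l`, the exchange does not increase the sum, and now the service of `i` lowers it by one.
      refine ⟨insert l (T.erase i), ?_, ?_, ?_⟩
      · exact Finset.insert_subset hlI ((Finset.erase_subset _ _).trans hT)
      · calc _ ≤ (T.erase i).card + 1 := Finset.card_insert_le _ _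
          _ = T.card := Finset.card_erase_add_one hm
          _ ≤ _ := hc
      · have hni : i ∉ insert l (T.erase i) := by simp [hil]
        have h2 := sum_sdiff_update_pred hi hni hpos
        have h3 : I \ insert l (T.erase i) = insert i ((I \ T).erase l) := by
          ext z
          simp only [Finset.mem_sdiff, Finset.mem_insert, Finset.mem_erase]
          constructor
          · rintro ⟨hz, hz'⟩
            by_cases hzi : z = i
            · exact Or.inl hzi
            · right; tauto
          · rintro (rfl | hz)
            · refine ⟨hi, ?_⟩
              simp [hil]
            · tauto
        have h4 : ∑ z ∈ I \ insert l (T.erase i), r z + r l = r i + ∑ z ∈ I \ T, r z := by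
          rw [h3, Finset.sum_insert, ← Finset.add_sum_erase _ _ hl]
          · ring
          · simp [hm]
        have := hmin l hlI hlpos
        omega
    · refine ⟨T, hT, hc, ?_⟩
      push Not at hex
      rw [Finset.sum_eq_zero]
      · exact Nat.zero_le _
      · intro l hl
        have := hle l
        have := hex l hl
        omega
  · refine ⟨T, hT, hc, ?_⟩
    have h2 := sum_sdiff_update_pred hi hm hpos
    omega

/-! ### Memorylessness of the exponential law -/

section Exponential

lemma lintegral_expMeasure {μ : ℝ} (φ : ℝ → ℝ≥0∞) (hφ : Measurable φ) :
    ∫⁻ z, φ z ∂(expMeasure μ)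
      = ∫⁻ z in Set.Ioi 0, ENNReal.ofReal (μ * Real.exp (-(μ * z))) * φ z := by
  have h : expMeasure μ = volume.withDensity (exponentialPDF μ) := rfl
  have hm : Measurable (exponentialPDF μ) :=
    (measurable_exponentialPDFReal μ).ennreal_ofReal
  rw [h, lintegral_withDensity_eq_lintegral_mul _ hm hφ,
    ← setLIntegral_congr Ioi_ae_eq_Ici.symm, ← lintegral_indicator measurableSet_Ici]
  refine lintegral_congr fun z => ?_
  by_cases hz : 0 ≤ z
  · rw [Set.indicator_of_mem (by exact hz), Pi.mul_apply, exponentialPDF_of_nonneg hz]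
  · rw [Set.indicator_of_notMem (by exact hz), Pi.mul_apply,
      exponentialPDF_of_neg (not_le.1 hz), zero_mul]

/-- The exponential law is memoryless. -/
lemma lintegral_expMeasure_shift {μ : ℝ} {a : ℝ} (ha : 0 ≤ a) (φ : ℝ → ℝ≥0∞)
    (hφ : Measurable φ) :
    ∫⁻ z, (Set.Ioi a).indicator (fun z => φ (z - a)) z ∂(expMeasure μ)
      = ENNReal.ofReal (Real.exp (-(μ * a))) * ∫⁻ z, φ z ∂(expMeasure μ) := by
  have hφa : Measurable fun z => φ (z - a) := hφ.comp (measurable_id.sub_const a)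
  rw [lintegral_expMeasure _ (hφa.indicator measurableSet_Ioi),
    lintegral_expMeasure _ hφ, ← lintegral_const_mul' _ _ ENNReal.ofReal_ne_top,
    ← lintegral_indicator measurableSet_Ioi, ← lintegral_indicator measurableSet_Ioi]
  conv_rhs => rw [← lintegral_sub_right_eq_self _ a]
  refine lintegral_congr fun z => ?_
  by_cases hz : a < z
  · rw [Set.indicator_of_mem (show z ∈ Set.Ioi (0 : ℝ) from ha.trans_lt hz),
      Set.indicator_of_mem (show z - a ∈ Set.Ioi (0 : ℝ) from sub_pos.2 hz),
      Set.indicator_of_mem (show z ∈ Set.Ioi a from hz), ← mul_assoc,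
      ← ENNReal.ofReal_mul (Real.exp_pos _).le]
    congr 2
    rw [mul_left_comm, ← Real.exp_add]
    ring_nf
  · rw [Set.indicator_of_notMem (show z - a ∉ Set.Ioi (0 : ℝ) by simpa using hz)]
    by_cases h0 : 0 < z
    · rw [Set.indicator_of_mem (show z ∈ Set.Ioi (0 : ℝ) from h0),
        Set.indicator_of_notMem (show z ∉ Set.Ioi a from hz), mul_zero]
    · rw [Set.indicator_of_notMem (show z ∉ Set.Ioi (0 : ℝ) from h0)]

end Exponential

/-! ### Memorylessness of an i.i.d. exponential family -/

section Product

variable {ι : Type*} [DecidableEq ι]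

/-- Resampling one coordinate of an i.i.d. family does not change its law. -/
lemma map_update_infinitePi (ν : Measure ℝ) [IsProbabilityMeasure ν] (j : ι) :
    ((Measure.infinitePi (fun _ : ι => ν)).prod ν).map
      (fun p : (ι → ℝ) × ℝ => Function.update p.1 j p.2)
      = Measure.infinitePi (fun _ : ι => ν) := by
  have hmeas : Measurable (fun p : (ι → ℝ) × ℝ => Function.update p.1 j p.2) := by
    refine measurable_pi_iff.2 fun c => ?_
    by_cases hc : c = j
    · subst hc; simpa using measurable_snd
    · simp only [Function.update_of_ne hc]; fun_prop
  refine Measure.eq_infinitePi _ fun s t ht => ?_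
  rw [Measure.map_apply hmeas (MeasurableSet.pi s.countable_toSet fun i _ => ht i)]
  by_cases hj : j ∈ s
  · have : (fun p : (ι → ℝ) × ℝ => Function.update p.1 j p.2) ⁻¹' (Set.pi s t)
        = (Set.pi (s.erase j : Finset ι) t) ×ˢ t j := by
      ext p
      simp only [Set.mem_preimage, Set.mem_pi, Set.mem_prod, Finset.mem_coe, Finset.mem_erase]
      constructor
      · intro h
        refine ⟨fun i hi => ?_, by simpa using h j hj⟩
        simpa [Function.update_of_ne hi.1] using h i hi.2
      · rintro ⟨h, h'⟩ i hi
        by_cases hij : i = j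
        · subst hij; simpa using h'
        · simpa [Function.update_of_ne hij] using h i ⟨hij, hi⟩
    rw [this, Measure.prod_prod, Measure.infinitePi_pi _ (fun i _ => ht i),
      Finset.prod_erase_mul _ _ hj]
  · have : (fun p : (ι → ℝ) × ℝ => Function.update p.1 j p.2) ⁻¹' (Set.pi s t)
        = (Set.pi s t) ×ˢ Set.univ := by
      ext p
      simp only [Set.mem_preimage, Set.mem_pi, Set.mem_prod, Finset.mem_coe, Set.mem_univ,
        and_true]
      refine forall₂_congr fun i hi => ?_
      rw [Function.update_of_ne]
      rintro rfl
      exact hj hi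
    rw [this, Measure.prod_prod, Measure.infinitePi_pi _ (fun i _ => ht i), measure_univ, mul_one]

lemma measurable_update_prod (j : ι) :
    Measurable (fun p : (ι → ℝ) × ℝ => Function.update p.1 j p.2) := by
  refine measurable_pi_iff.2 fun c => ?_
  by_cases hc : c = j
  · subst hc; simpa using measurable_snd
  · simp only [Function.update_of_ne hc]; fun_prop

/-- A single coordinate becomes an integration variable of its own without splitting the infinite
product into one factor and the rest. -/
lemma lintegral_resample (ν : Measure ℝ) [IsProbabilityMeasure ν] (j : ι) (G : (ι → ℝ) → ℝ≥0∞)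
    (hG : Measurable G) :
    ∫⁻ x, G x ∂(Measure.infinitePi (fun _ : ι => ν))
      = ∫⁻ x, ∫⁻ z, G (Function.update x j z) ∂ν ∂(Measure.infinitePi (fun _ : ι => ν)) := by
  conv_lhs => rw [← map_update_infinitePi ν j]
  rw [lintegral_map hG (measurable_update_prod j),
    lintegral_prod (fun p : (ι → ℝ) × ℝ => G (Function.update p.1 j p.2))
      (hG.comp (measurable_update_prod j)).aemeasurable]

lemma lintegral_resample_swap (ν : Measure ℝ) [IsProbabilityMeasure ν] (j : ι)
    (G : (ι → ℝ) → ℝ≥0∞) (hG : Measurable G) :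
    ∫⁻ x, G x ∂(Measure.infinitePi (fun _ : ι => ν))
      = ∫⁻ z, ∫⁻ x, G (Function.update x j z) ∂(Measure.infinitePi (fun _ : ι => ν)) ∂ν := by
  rw [lintegral_resample ν j G hG, lintegral_lintegral_swap]
  exact (hG.comp (measurable_update_prod j)).aemeasurable

/-- Subtract `a c` from the coordinates `c ∈ S`. -/
def shift (S : Finset ι) (a : ι → ℝ) (x : ι → ℝ) : ι → ℝ :=
  fun c => if c ∈ S then x c - a c else x c

lemma measurable_shift (S : Finset ι) (a : ι → ℝ) : Measurable (shift S a) := by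
  refine measurable_pi_iff.2 fun c => ?_
  by_cases hc : c ∈ S
  · simp only [shift, hc, if_true]; fun_prop
  · simp only [shift, hc, if_false]; fun_prop

lemma measurableSet_forall_lt {ι : Type*} (S : Finset ι) (a : ι → ℝ) :
    MeasurableSet {x : ι → ℝ | ∀ c ∈ S, a c < x c} := by
  have : {x : ι → ℝ | ∀ c ∈ S, a c < x c} = ⋂ c ∈ S, {x | a c < x c} := by
    ext; simp
  rw [this]
  exact Finset.measurableSet_biInter _ fun c _ =>
    measurableSet_lt measurable_const (measurable_pi_apply c)

/-- Memorylessness of an i.i.d. family of exponential variables. -/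
lemma lintegral_memoryless {μ : ℝ} (hμ : 0 < μ) (a : ι → ℝ) (S : Finset ι) :
    (∀ c ∈ S, 0 ≤ a c) → ∀ h : (ι → ℝ) → ℝ≥0∞, Measurable h →
    ∫⁻ x, {x : ι → ℝ | ∀ c ∈ S, a c < x c}.indicator (fun x => h (shift S a x)) x
        ∂(Measure.infinitePi (fun _ : ι => expMeasure μ))
      = ENNReal.ofReal (Real.exp (-(μ * ∑ c ∈ S, a c)))
        * ∫⁻ x, h x ∂(Measure.infinitePi (fun _ : ι => expMeasure μ)) := by
  have := isProbabilityMeasure_expMeasure hμ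
  induction S using Finset.induction_on with
  | empty =>
    intro _ h _
    have : shift (∅ : Finset ι) a = id := by ext; simp [shift]
    simp [this]
  | insert j S hj ih =>
    intro ha h hh
    have hmeas : Measurable fun x => {x : ι → ℝ | ∀ c ∈ insert j S, a c < x c}.indicator
        (fun x => h (shift (insert j S) a x)) x :=
      (hh.comp (measurable_shift _ _)).indicator (measurableSet_forall_lt _ _)
    rw [lintegral_resample (expMeasure μ) j _ hmeas]
    have hupd : Measurable fun p : (ι → ℝ) × ℝ => h (Function.update p.1 j p.2) :=
      hh.comp (measurable_update_prod j)
    -- For a fixed `x`, the integral over the resampled coordinate `j` is the one-dimensional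
    -- memoryless law. The induction hypothesis is then applied to the average of `h` over that
    -- coordinate.
    have hinner : ∀ x : ι → ℝ, ∫⁻ z, {x : ι → ℝ | ∀ c ∈ insert j S, a c < x c}.indicator
          (fun x => h (shift (insert j S) a x)) (Function.update x j z) ∂(expMeasure μ)
        = ENNReal.ofReal (Real.exp (-(μ * a j))) *
          {x : ι → ℝ | ∀ c ∈ S, a c < x c}.indicator
            (fun x => (fun y => ∫⁻ z, h (Function.update y j z) ∂(expMeasure μ)) (shift S a x)) x
        := by
      intro x
      by_cases hx : ∀ c ∈ S, a c < x c
      · rw [Set.indicator_of_mem (by exact hx),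
          ← lintegral_expMeasure_shift (ha j (Finset.mem_insert_self j S))
            (fun z => h (Function.update (shift S a x) j z))
            (hupd.comp measurable_prodMk_left)]
        refine lintegral_congr fun z => ?_
        by_cases hz : a j < z
        · rw [Set.indicator_of_mem (show z ∈ Set.Ioi (a j) from hz), Set.indicator_of_mem]
          · congr 1
            ext c
            by_cases hc : c = j
            · subst hc; simp [shift]
            · simp [shift, hc, Function.update_of_ne]
          · intro c hc
            by_cases hcj : c = j
            · subst hcj; simpa using hz
            · rw [Function.update_of_ne hcj]
              exact hx c ((Finset.mem_insert.1 hc).resolve_left hcj)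
        · rw [Set.indicator_of_notMem (show z ∉ Set.Ioi (a j) from hz), Set.indicator_of_notMem]
          intro hall
          exact hz (by simpa using hall j (Finset.mem_insert_self j S))
      · rw [Set.indicator_of_notMem (by exact hx), mul_zero]
        refine (lintegral_congr fun z => ?_).trans lintegral_zero
        rw [Set.indicator_of_notMem]
        intro hall
        refine hx fun c hc => ?_
        have hcj : c ≠ j := by rintro rfl; exact hj hc
        simpa [Function.update_of_ne hcj] using hall c (Finset.mem_insert_of_mem hc)
    rw [lintegral_congr hinner, lintegral_const_mul' _ _ ENNReal.ofReal_ne_top,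
      ih (fun c hc => ha c (Finset.mem_insert_of_mem hc)) _ hupd.lintegral_prod_right',
      ← lintegral_resample (expMeasure μ) j h hh, ← mul_assoc,
      ← ENNReal.ofReal_mul (Real.exp_pos _).le, ← Real.exp_add, Finset.sum_insert hj]
    ring_nf

end Product

/-! ### First passage times of cumulated service -/

section FirstPassage

/-- `A` is the cumulated service from time `t₀` on, at rate `a`. -/
structure IsCumulative (t₀ : ℝ) (a : ℝ → ℝ≥0∞) (A : ℝ → ℝ) : Prop where
  monotone : Monotone A
  continuous : Continuous A
  zero : A t₀ = 0
  measurable : Measurable a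
  lintegral : ∀ t, t₀ ≤ t → ∫⁻ s in Set.Ioc t₀ t, a s = ENNReal.ofReal (A t)

/-- The levels that are exceeded sooner or later. -/
def reachable (A : ℝ → ℝ) : Set ℝ := {z | 0 < z ∧ ∃ t, z ≤ A t}

lemma measurableSet_reachable (A : ℝ → ℝ) : MeasurableSet (reachable A) := by
  have : Set.OrdConnected (reachable A) := by
    refine ⟨fun x hx y hy z hz => ?_⟩
    obtain ⟨t, ht⟩ := hy.2
    exact ⟨hx.1.trans_le hz.1, t, hz.2.trans ht⟩
  exact this.measurableSet

/-- The first time at which the level `z` is reached. -/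
noncomputable def firstPassage (t₀ : ℝ) (A : ℝ → ℝ) (z : ℝ) : ℝ :=
  (reachable A).indicator (fun z => sInf {t | t₀ ≤ t ∧ z ≤ A t}) z

variable {t₀ : ℝ} {a : ℝ → ℝ≥0∞} {A : ℝ → ℝ}

/-- Continuity makes the set of times at which level `z` has been reached closed, so the infimum is
attained; monotonicity does the rest. Reachable levels are positive, so no time up to `t₀`
qualifies. -/
lemma IsCumulative.firstPassage_le_iff (h : IsCumulative t₀ a A) {z : ℝ} (hz : z ∈ reachable A)
    (t : ℝ) : firstPassage t₀ A z ≤ t ↔ z ≤ A t := by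
  have hlow : ∀ s, s ≤ t₀ → A s < z := fun s hs =>
    ((h.monotone hs).trans_eq h.zero).trans_lt hz.1
  rw [firstPassage, Set.indicator_of_mem hz]
  have hbdd : BddBelow {t | t₀ ≤ t ∧ z ≤ A t} := ⟨t₀, fun t ht => ht.1⟩
  have hclosed : IsClosed {t | t₀ ≤ t ∧ z ≤ A t} :=
    isClosed_Ici.inter (isClosed_le continuous_const h.continuous)
  have hne : {t | t₀ ≤ t ∧ z ≤ A t}.Nonempty := by
    obtain ⟨s, hs⟩ := hz.2
    refine ⟨s, ?_, hs⟩
    by_contra hlt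
    exact absurd hs (not_le.2 (hlow s (not_le.1 hlt).le))
  constructor
  · intro hle
    exact (hclosed.csInf_mem hne hbdd).2.trans (h.monotone hle)
  · intro hle
    refine csInf_le hbdd ⟨?_, hle⟩
    by_contra hlt
    exact absurd hle (not_le.2 (hlow t (not_le.1 hlt).le))

lemma IsCumulative.lt_firstPassage (h : IsCumulative t₀ a A) {z : ℝ} (hz : z ∈ reachable A) :
    t₀ < firstPassage t₀ A z := by
  by_contra hle
  have := (h.firstPassage_le_iff hz t₀).1 (not_lt.1 hle)
  rw [h.zero] at this
  exact absurd hz.1 (not_lt.2 this)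

lemma IsCumulative.apply_firstPassage (h : IsCumulative t₀ a A) {z : ℝ} (hz : z ∈ reachable A) :
    A (firstPassage t₀ A z) = z := by
  refine le_antisymm ?_ ((h.firstPassage_le_iff hz _).1 le_rfl)
  refine le_of_tendsto (h.continuous.continuousWithinAt (s := Set.Iio (firstPassage t₀ A z))) ?_
  filter_upwards [self_mem_nhdsWithin] with s hs
  by_contra hlt
  exact absurd ((h.firstPassage_le_iff hz s).2 (not_le.1 hlt).le) (not_le.2 hs)

lemma IsCumulative.measurable_firstPassage (h : IsCumulative t₀ a A) :
    Measurable (firstPassage t₀ A) := by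
  refine measurable_of_Iic fun t => ?_
  -- Outside the reachable levels the passage time has the default value 0, hence the second piece.
  have : firstPassage t₀ A ⁻¹' Set.Iic t
      = (reachable A ∩ Set.Iic (A t)) ∪ ((reachable A)ᶜ ∩ {_z | 0 ≤ t}) := by
    ext z
    by_cases hz : z ∈ reachable A
    · simp [hz, h.firstPassage_le_iff hz]
    · simp [hz, firstPassage]
  rw [this]
  exact ((measurableSet_reachable A).inter measurableSet_Iic).union
    ((measurableSet_reachable A).compl.inter (MeasurableSet.const _))

/-- Change of variables between levels and times. -/
lemma IsCumulative.lintegral_comp_firstPassage (h : IsCumulative t₀ a A) (φ : ℝ → ℝ≥0∞)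
    (hφ : Measurable φ) :
    ∫⁻ z in reachable A, φ (firstPassage t₀ A z) = ∫⁻ t in Set.Ioi t₀, a t * φ t := by
  -- Lebesgue measure on the levels is carried by the passage time to the measure with density `a`
  -- on the times. It suffices to compare half-open intervals: the levels passed during (p, q] are
  -- those in (A (max p t₀), A q].
  have key : (volume.restrict (reachable A)).map (firstPassage t₀ A)
      = (volume.restrict (Set.Ioi t₀)).withDensity a := by
    have hval : ∀ ⦃p q : ℝ⦄, p < q →
        (volume.restrict (reachable A)).map (firstPassage t₀ A) (Set.Ioc p q)
          = ENNReal.ofReal (A q - A (max p t₀)) := by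
      intro p q _
      rw [Measure.map_apply h.measurable_firstPassage measurableSet_Ioc,
        Measure.restrict_apply (h.measurable_firstPassage measurableSet_Ioc), ← Real.volume_Ioc]
      congr 1
      ext z
      simp only [Set.mem_inter_iff, Set.mem_preimage, Set.mem_Ioc]
      rw [h.monotone.map_max, h.zero, max_lt_iff]
      constructor
      · rintro ⟨⟨h1, h2⟩, hz⟩
        rw [h.firstPassage_le_iff hz] at h2
        rw [← not_le, h.firstPassage_le_iff hz, not_le] at h1
        exact ⟨⟨h1, hz.1⟩, h2⟩
      · rintro ⟨⟨h1, h0⟩, h2⟩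
        have hz : z ∈ reachable A := ⟨h0, q, h2⟩
        refine ⟨⟨?_, (h.firstPassage_le_iff hz _).2 h2⟩, hz⟩
        rw [← not_le, h.firstPassage_le_iff hz, not_le]
        exact h1
    refine Measure.ext_of_Ioc' _ _ (fun p q hpq => ?_) (fun p q hpq => ?_)
    · rw [hval hpq]; exact ENNReal.ofReal_ne_top
    · rw [hval hpq, withDensity_apply _ measurableSet_Ioc,
        Measure.restrict_restrict measurableSet_Ioc]
      have hset : Set.Ioc p q ∩ Set.Ioi t₀ = Set.Ioc (max p t₀) q := by
        ext z; simp only [Set.mem_inter_iff, Set.mem_Ioc, Set.mem_Ioi, max_lt_iff]; tauto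
      rw [hset]
      by_cases hq : max p t₀ ≤ q
      · have hsplit : Set.Ioc t₀ q = Set.Ioc t₀ (max p t₀) ∪ Set.Ioc (max p t₀) q :=
          (Set.Ioc_union_Ioc_eq_Ioc (le_max_right _ _) hq).symm
        have hd : Disjoint (Set.Ioc t₀ (max p t₀)) (Set.Ioc (max p t₀) q) := by
          rw [Set.disjoint_left]
          intro z hz hz'
          exact absurd hz.2 (not_le.2 hz'.1)
        have h1 := h.lintegral q ((le_max_right _ _).trans hq)
        rw [hsplit, lintegral_union measurableSet_Ioc hd, h.lintegral _ (le_max_right _ _)] at h1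
        have h0 : 0 ≤ A (max p t₀) := h.zero.symm.le.trans (h.monotone (le_max_right _ _))
        rw [ENNReal.ofReal_sub _ h0, ← h1, ENNReal.add_sub_cancel_left ENNReal.ofReal_ne_top]
      · rw [Set.Ioc_eq_empty (fun h' => hq h'.le), setLIntegral_empty, ENNReal.ofReal_eq_zero]
        exact sub_nonpos.2 (h.monotone (not_le.1 hq).le)
  calc ∫⁻ z in reachable A, φ (firstPassage t₀ A z)
      = ∫⁻ t, φ t ∂((volume.restrict (reachable A)).map (firstPassage t₀ A)) :=
        (lintegral_map hφ h.measurable_firstPassage).symm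
    _ = _ := by
        rw [key, lintegral_withDensity_eq_lintegral_mul _ h.measurable hφ]
        rfl

end FirstPassage

/-! ### Competition of exponential clocks -/

section FirstEvent

variable {ι : Type*} [DecidableEq ι]

/-- Among the clocks `c ∈ S`, which run at speed `A c` and expire at level `x c`, the clock `j` is
the first to expire. -/
def firstEvent (t₀ : ℝ) (A : ι → ℝ → ℝ) (S : Finset ι) (j : ι) : Set (ι → ℝ) :=
  {x | x j ∈ reachable (A j) ∧ ∀ c ∈ S.erase j, A c (firstPassage t₀ (A j) (x j)) < x c}

lemma IsCumulative.nonneg {t₀ : ℝ} {a : ℝ → ℝ≥0∞} {A : ℝ → ℝ} (h : IsCumulative t₀ a A) {t : ℝ}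
    (ht : t₀ ≤ t) : 0 ≤ A t :=
  h.zero.symm.le.trans (h.monotone ht)

variable {t₀ : ℝ} {a : ι → ℝ → ℝ≥0∞} {A : ι → ℝ → ℝ} {S : Finset ι}

lemma measurableSet_firstEvent (hA : ∀ j ∈ S, IsCumulative t₀ (a j) (A j)) {j : ι} (hj : j ∈ S) :
    MeasurableSet (firstEvent t₀ A S j) := by
  have : firstEvent t₀ A S j = {x : ι → ℝ | x j ∈ reachable (A j)} ∩
      ⋂ c ∈ S.erase j, {x | A c (firstPassage t₀ (A j) (x j)) < x c} := by
    ext; simp [firstEvent]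
  rw [this]
  refine MeasurableSet.inter (measurable_pi_apply j (measurableSet_reachable _))
    (Finset.measurableSet_biInter _ fun c hc => measurableSet_lt ?_ (measurable_pi_apply c))
  exact (hA c (Finset.mem_of_mem_erase hc)).continuous.measurable.comp
    ((hA j hj).measurable_firstPassage.comp (measurable_pi_apply j))

lemma disjoint_firstEvent (hA : ∀ j ∈ S, IsCumulative t₀ (a j) (A j)) {i j : ι} (hi : i ∈ S)
    (hj : j ∈ S) (hij : i ≠ j) : Disjoint (firstEvent t₀ A S i) (firstEvent t₀ A S j) := by
  rw [Set.disjoint_left]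
  rintro x ⟨hxi, hi'⟩ ⟨hxj, hj'⟩
  have h1 := hi' j (Finset.mem_erase.2 ⟨hij.symm, hj⟩)
  have h2 := hj' i (Finset.mem_erase.2 ⟨hij, hi⟩)
  rcases le_total (firstPassage t₀ (A i) (x i)) (firstPassage t₀ (A j) (x j)) with h | h
  · exact absurd (((hA i hi).firstPassage_le_iff hxi _).1 h) (not_le.2 h2)
  · exact absurd (((hA j hj).firstPassage_le_iff hxj _).1 h) (not_le.2 h1)

lemma measurable_shift_prod (hA : ∀ j ∈ S, IsCumulative t₀ (a j) (A j)) :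
    Measurable fun p : ℝ × (ι → ℝ) => shift S (fun c => A c p.1) p.2 := by
  refine measurable_pi_iff.2 fun c => ?_
  by_cases hc : c ∈ S
  · simp only [shift, hc, if_true]
    exact ((measurable_pi_apply c).comp measurable_snd).sub
      ((hA c hc).continuous.measurable.comp measurable_fst)
  · simp only [shift, hc, if_false]
    exact (measurable_pi_apply c).comp measurable_snd

/-- Fix the level z of clock `j`, which expires at τ(z). The other clocks must survive the service
received by then, which has probability exp(-μ ∑ A c (τ z)), and their residuals are then fresh.
Clock `j` itself has received z, so this factor times exp(-μ z) is exp(-μ L (τ z - t₀)),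
independently of how the service was divided. Passing from levels to times brings in the rate `a j`.
-/
lemma lintegral_firstEvent {μ L : ℝ} (hμ : 0 < μ)
    (hA : ∀ j ∈ S, IsCumulative t₀ (a j) (A j))
    (hsum : ∀ t, t₀ ≤ t → ∑ c ∈ S, A c t = L * (t - t₀)) {j : ι} (hj : j ∈ S)
    (g : ℝ → (ι → ℝ) → ℝ≥0∞) (hg : Measurable fun p : ℝ × (ι → ℝ) => g p.1 p.2)
    (hdep : ∀ t y y', (∀ c ∈ S.erase j, y c = y' c) → g t y = g t y') :
    ∫⁻ x, (firstEvent t₀ A S j).indicator (fun x => g (firstPassage t₀ (A j) (x j))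
        (fun c => x c - A c (firstPassage t₀ (A j) (x j)))) x
        ∂(Measure.infinitePi (fun _ : ι => expMeasure μ))
      = ∫⁻ t in Set.Ioi t₀, ENNReal.ofReal (Real.exp (-(μ * L * (t - t₀)))) *
          (ENNReal.ofReal μ * a j t *
            ∫⁻ y, g t y ∂(Measure.infinitePi (fun _ : ι => expMeasure μ))) := by
  have := isProbabilityMeasure_expMeasure hμ
  set P := Measure.infinitePi (fun _ : ι => expMeasure μ) with hP
  set τ := firstPassage t₀ (A j) with hτ
  have hAj := hA j hj
  have hτm : Measurable τ := hAj.measurable_firstPassage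
  -- only the residuals of the other clocks matter
  have hshift : ∀ t x, g t (fun c => x c - A c t)
      = g t (shift (S.erase j) (fun c => A c t) x) := by
    intro t x
    refine hdep _ _ _ fun c hc => ?_
    simp [shift, hc]
  have hshm := measurable_shift_prod (fun c hc => hA c (Finset.mem_of_mem_erase (a := j) hc))
  have hbar : Measurable fun t => ∫⁻ y, g t y ∂P := hg.lintegral_prod_right'
  have hmeas : Measurable fun x => (firstEvent t₀ A S j).indicator (fun x => g (τ (x j))
      (fun c => x c - A c (τ (x j)))) x := by
    refine Measurable.indicator ?_ (measurableSet_firstEvent hA hj)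
    simp only [hshift]
    exact hg.comp ((hτm.comp (measurable_pi_apply j)).prodMk
      (hshm.comp ((hτm.comp (measurable_pi_apply j)).prodMk measurable_id)))
  rw [lintegral_resample_swap (expMeasure μ) j _ hmeas]
  have hinner : ∀ z, ∫⁻ x, (firstEvent t₀ A S j).indicator (fun x => g (τ (x j))
        (fun c => x c - A c (τ (x j)))) (Function.update x j z) ∂P
      = (reachable (A j)).indicator (fun z =>
          ENNReal.ofReal (Real.exp (-(μ * ∑ c ∈ S.erase j, A c (τ z)))) * ∫⁻ y, g (τ z) y ∂P) z
      := by
    intro z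
    by_cases hz : z ∈ reachable (A j)
    · rw [Set.indicator_of_mem hz, ← lintegral_memoryless hμ (fun c => A c (τ z)) (S.erase j)
        (fun c hc => (hA c (Finset.mem_of_mem_erase hc)).nonneg (hAj.lt_firstPassage hz).le)
        (g (τ z)) (hg.comp measurable_prodMk_left)]
      refine lintegral_congr fun x => ?_
      by_cases hx : ∀ c ∈ S.erase j, A c (τ z) < x c
      · rw [Set.indicator_of_mem (show x ∈ {x : ι → ℝ | ∀ c ∈ S.erase j, A c (τ z) < x c} from hx),
          Set.indicator_of_mem, hshift]
        · simp only [Function.update_self]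
          refine hdep _ _ _ fun c hc => ?_
          simp [shift, hc, Function.update_of_ne (Finset.ne_of_mem_erase hc)]
        · refine ⟨by simpa using hz, fun c hc => ?_⟩
          rw [Function.update_self, Function.update_of_ne (Finset.ne_of_mem_erase hc)]
          exact hx c hc
      · rw [Set.indicator_of_notMem
          (show x ∉ {x : ι → ℝ | ∀ c ∈ S.erase j, A c (τ z) < x c} from hx),
          Set.indicator_of_notMem]
        rintro ⟨-, hall⟩
        refine hx fun c hc => ?_
        have := hall c hc
        rwa [Function.update_self, Function.update_of_ne (Finset.ne_of_mem_erase hc)] at this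
    · rw [Set.indicator_of_notMem hz]
      refine (lintegral_congr fun x => ?_).trans lintegral_zero
      rw [Set.indicator_of_notMem]
      rintro ⟨h, -⟩
      exact hz (by simpa using h)
  rw [lintegral_congr hinner]
  have hsumm : Measurable fun t => ∑ c ∈ S.erase j, A c t :=
    Finset.measurable_fun_sum _ fun c hc =>
      (hA c (Finset.mem_of_mem_erase hc)).continuous.measurable
  have hm2 : Measurable fun z => (reachable (A j)).indicator (fun z =>
          ENNReal.ofReal (Real.exp (-(μ * ∑ c ∈ S.erase j, A c (τ z)))) * ∫⁻ y, g (τ z) y ∂P) z := by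
    refine Measurable.indicator ?_ (measurableSet_reachable _)
    refine Measurable.mul (ENNReal.measurable_ofReal.comp (Real.measurable_exp.comp
      ((hsumm.comp hτm).const_mul μ).neg)) (hbar.comp hτm)
  have hφ : Measurable fun t => ENNReal.ofReal (Real.exp (-(μ * L * (t - t₀)))) *
      (ENNReal.ofReal μ * ∫⁻ y, g t y ∂P) :=
    Measurable.mul (by fun_prop) (hbar.const_mul _)
  rw [lintegral_expMeasure _ hm2]
  have hstep : ∫⁻ t in Set.Ioi t₀, ENNReal.ofReal (Real.exp (-(μ * L * (t - t₀)))) *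
          (ENNReal.ofReal μ * a j t * ∫⁻ y, g t y ∂P)
      = ∫⁻ t in Set.Ioi t₀, a j t * (ENNReal.ofReal (Real.exp (-(μ * L * (t - t₀)))) *
          (ENNReal.ofReal μ * ∫⁻ y, g t y ∂P)) :=
    lintegral_congr fun t => by ring
  rw [hstep, ← hAj.lintegral_comp_firstPassage _ hφ, ← lintegral_indicator measurableSet_Ioi,
    ← lintegral_indicator (measurableSet_reachable _)]
  refine lintegral_congr fun z => ?_
  by_cases hz : z ∈ reachable (A j)
  · rw [Set.indicator_of_mem (show z ∈ Set.Ioi (0 : ℝ) from hz.1), Set.indicator_of_mem hz,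
      Set.indicator_of_mem hz, ENNReal.ofReal_mul hμ.le]
    have hs := hsum (τ z) (hAj.lt_firstPassage hz).le
    rw [← Finset.add_sum_erase _ _ hj, hAj.apply_firstPassage hz] at hs
    have he : Real.exp (-(μ * L * (τ z - t₀)))
        = Real.exp (-(μ * z)) * Real.exp (-(μ * ∑ c ∈ S.erase j, A c (τ z))) := by
      rw [← Real.exp_add, mul_assoc, ← hs]
      ring_nf
    rw [← hτ, he, ENNReal.ofReal_mul (Real.exp_pos _).le]
    ring
  · rw [Set.indicator_of_notMem hz, Set.indicator_apply]
    split_ifs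
    · rw [Set.indicator_of_notMem hz, mul_zero]
    · rfl

lemma setLIntegral_exp_Ioi {r : ℝ} (hr : 0 < r) (t₀ : ℝ) :
    ∫⁻ t in Set.Ioi t₀, ENNReal.ofReal (Real.exp (-(r * (t - t₀)))) = ENNReal.ofReal r⁻¹ := by
  have h1 : ∀ t, Real.exp (-(r * (t - t₀))) = Real.exp (r * t₀) * Real.exp (-r * t) := by
    intro t
    rw [← Real.exp_add]
    ring_nf
  have h2 : IntegrableOn (fun t => Real.exp (r * t₀) * Real.exp (-r * t)) (Set.Ioi t₀) :=
    (integrableOn_exp_mul_Ioi (by linarith) t₀).const_mul _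
  simp only [h1]
  rw [← ofReal_integral_eq_lintegral_ofReal h2
    (Eventually.of_forall fun t => by positivity), integral_const_mul,
    integral_exp_mul_Ioi (by linarith)]
  congr 1
  rw [show -r * t₀ = -(r * t₀) by ring, Real.exp_neg]
  field_simp

/-- The competition of exponential clocks, conditioned on the first one to expire: the residuals of
the others are fresh. -/
theorem lintegral_eq_of_firstEvent {μ L : ℝ} (hμ : 0 < μ) (hL : 0 < L)
    (hA : ∀ j ∈ S, IsCumulative t₀ (a j) (A j))
    (hsum : ∀ t, t₀ ≤ t → ∑ c ∈ S, A c t = L * (t - t₀))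
    (hsum' : ∀ t, t₀ < t → ∑ c ∈ S, a c t = ENNReal.ofReal L)
    (g : ι → ℝ → (ι → ℝ) → ℝ≥0∞)
    (hg : ∀ j ∈ S, Measurable fun p : ℝ × (ι → ℝ) => g j p.1 p.2)
    (hdep : ∀ j ∈ S, ∀ t y y', (∀ c ∈ S.erase j, y c = y' c) → g j t y = g j t y')
    (G : (ι → ℝ) → ℝ≥0∞)
    (hG : ∀ j ∈ S, ∀ x ∈ firstEvent t₀ A S j, G x = g j (firstPassage t₀ (A j) (x j))
      (fun c => x c - A c (firstPassage t₀ (A j) (x j)))) :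
    ∫⁻ x, G x ∂(Measure.infinitePi (fun _ : ι => expMeasure μ))
      = ∫⁻ t in Set.Ioi t₀, ENNReal.ofReal (Real.exp (-(μ * L * (t - t₀)))) *
          ∑ j ∈ S, (ENNReal.ofReal μ * a j t *
            ∫⁻ y, g j t y ∂(Measure.infinitePi (fun _ : ι => expMeasure μ))) := by
  have := isProbabilityMeasure_expMeasure hμ
  set P := Measure.infinitePi (fun _ : ι => expMeasure μ) with hP
  set E := fun j => firstEvent t₀ A S j with hE
  have hEm : ∀ j ∈ S, MeasurableSet (E j) := fun j hj => measurableSet_firstEvent hA hj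
  -- The events are disjoint, and their probabilities, computed with g = 1, add up to the integral
  -- of the exponential density of rate μL. So almost surely some clock is strictly first, and the
  -- values of `G` elsewhere do not matter.
  have hcover : P (⋃ j ∈ S, E j) = 1 := by
    rw [measure_biUnion_finset (fun i hi j hj hij => disjoint_firstEvent hA hi hj hij) hEm]
    have h1 : ∀ j ∈ S, P (E j) = ∫⁻ t in Set.Ioi t₀,
        ENNReal.ofReal (Real.exp (-(μ * L * (t - t₀)))) * (ENNReal.ofReal μ * a j t) := by
      intro j hj
      have := lintegral_firstEvent hμ hA hsum hj (fun _ _ => 1) measurable_const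
        (fun _ _ _ _ => rfl)
      rw [lintegral_indicator (hEm j hj)] at this
      simpa using this
    rw [Finset.sum_congr rfl h1, ← lintegral_finsetSum']
    · have h2 : ∀ t ∈ Set.Ioi t₀, ∑ j ∈ S,
          ENNReal.ofReal (Real.exp (-(μ * L * (t - t₀)))) * (ENNReal.ofReal μ * a j t)
          = ENNReal.ofReal (μ * L) * ENNReal.ofReal (Real.exp (-(μ * L * (t - t₀)))) := by
        intro t ht
        rw [← Finset.mul_sum, ← Finset.mul_sum, hsum' t ht, ENNReal.ofReal_mul hμ.le, mul_comm]
      rw [setLIntegral_congr_fun measurableSet_Ioi h2,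
        lintegral_const_mul' _ _ ENNReal.ofReal_ne_top, setLIntegral_exp_Ioi (by positivity),
        ← ENNReal.ofReal_mul (by positivity), mul_inv_cancel₀ (by positivity), ENNReal.ofReal_one]
    · intro j hj
      have := (hA j hj).measurable
      exact Measurable.aemeasurable (by fun_prop)
  have hae : G =ᵐ[P] fun x => ∑ j ∈ S, (E j).indicator (fun x =>
      g j (firstPassage t₀ (A j) (x j)) (fun c => x c - A c (firstPassage t₀ (A j) (x j)))) x := by
    have h0 : ∀ᵐ x ∂P, x ∈ ⋃ j ∈ S, E j := by
      rw [← prob_compl_eq_zero_iff (Finset.measurableSet_biUnion _ hEm)] at hcover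
      exact hcover
    filter_upwards [h0] with x hx
    simp only [Set.mem_iUnion] at hx
    obtain ⟨j, hj, hxj⟩ := hx
    rw [Finset.sum_eq_single_of_mem j hj, Set.indicator_of_mem hxj]
    · exact hG j hj x hxj
    · intro i hi hij
      rw [Set.indicator_of_notMem]
      exact Set.disjoint_right.1 (disjoint_firstEvent hA hi hj hij) hxj
  have hbar : ∀ j ∈ S, Measurable fun t => ∫⁻ y, g j t y ∂P :=
    fun j hj => (hg j hj).lintegral_prod_right'
  rw [lintegral_congr_ae hae, lintegral_finsetSum']
  · rw [Finset.sum_congr rfl fun j hj =>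
      lintegral_firstEvent hμ hA hsum hj (g j) (hg j hj) (hdep j hj), ← lintegral_finsetSum']
    · exact lintegral_congr fun t => (Finset.mul_sum _ _ _).symm
    · intro j hj
      have h1 := (hA j hj).measurable
      have h2 := hbar j hj
      exact Measurable.aemeasurable (by fun_prop)
  · intro j hj
    refine (Measurable.indicator ?_ (hEm j hj)).aemeasurable
    have hτm := (hA j hj).measurable_firstPassage
    have hshift : ∀ t x, g j t (fun c => x c - A c t)
        = g j t (shift (S.erase j) (fun c => A c t) x) := by
      intro t x
      refine hdep j hj _ _ _ fun c hc => ?_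
      simp [shift, hc]
    simp only [hshift]
    have hshm := measurable_shift_prod (fun c hc => hA c (Finset.mem_of_mem_erase (a := j) hc))
    exact (hg j hj).comp ((hτm.comp (measurable_pi_apply j)).prodMk
      (hshm.comp ((hτm.comp (measurable_pi_apply j)).prodMk measurable_id)))

end FirstEvent

/-! ### Measurable dependence of logs and service on the sample point -/

section Measurability

variable {X : Type*} [MeasurableSpace X]

/-- The log depends measurably on the sample point. -/
def LogMeasurable (l : X → DownloadLog) : Prop :=
  (∀ cs : List (Finset Chunk), MeasurableSet {x | (l x).map Prod.snd = cs}) ∧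
    ∀ j : ℕ, Measurable fun x => (((l x)[j]?).map Prod.fst).getD 0

/-- There are only countably many patterns, since finite sets of chunks form a countable type. -/
lemma LogMeasurable.measurableSet_pattern {l : X → DownloadLog} (hl : LogMeasurable l)
    (Q : List (Finset Chunk) → Prop) : MeasurableSet {x | Q ((l x).map Prod.snd)} := by
  have : {x | Q ((l x).map Prod.snd)}
      = ⋃ cs : {cs : List (Finset Chunk) // Q cs}, {x | (l x).map Prod.snd = cs.1} := by
    ext x; simp
  rw [this]
  exact MeasurableSet.iUnion fun cs => hl.1 cs.1

lemma downloaded_eq (l : DownloadLog) :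
    downloaded l = (l.map Prod.snd).foldr (fun e s => e ∪ s) ∅ := by
  rw [downloaded, List.foldr_map]

lemma downloaded_append (l : DownloadLog) (t : ℝ) (A : Finset Chunk) :
    downloaded (l ++ [(t, A)]) = downloaded l ∪ A := by
  induction l with
  | nil => simp [downloaded]
  | cons e l ih =>
    simp only [downloaded, List.cons_append, List.foldr_cons] at ih ⊢
    rw [ih, Finset.union_assoc]

lemma LogMeasurable.measurableSet_downloaded {l : X → DownloadLog} (hl : LogMeasurable l)
    (Q : Finset Chunk → Prop) : MeasurableSet {x | Q (downloaded (l x))} := by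
  simp only [downloaded_eq]
  exact hl.measurableSet_pattern fun cs => Q (cs.foldr (fun e s => e ∪ s) ∅)

lemma LogMeasurable.comp {Y : Type*} [MeasurableSpace Y] {l : X → DownloadLog}
    (hl : LogMeasurable l) {f : Y → X} (hf : Measurable f) : LogMeasurable fun y => l (f y) :=
  ⟨fun cs => hf (hl.1 cs), fun j => (hl.2 j).comp hf⟩

lemma logMeasurable_const (l : DownloadLog) : LogMeasurable fun _ : X => l :=
  ⟨fun _ => MeasurableSet.const _, fun _ => measurable_const⟩

lemma LogMeasurable.ite {l l' : X → DownloadLog} (hl : LogMeasurable l) (hl' : LogMeasurable l')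
    {p : X → Prop} [DecidablePred p] (hp : MeasurableSet {x | p x}) :
    LogMeasurable fun x => if p x then l x else l' x := by
  constructor
  · intro cs
    have : {x | (if p x then l x else l' x).map Prod.snd = cs}
        = ({x | p x} ∩ {x | (l x).map Prod.snd = cs})
          ∪ ({x | p x}ᶜ ∩ {x | (l' x).map Prod.snd = cs}) := by
      ext x; by_cases hx : p x <;> simp [hx]
    rw [this]
    exact (hp.inter (hl.1 cs)).union (hp.compl.inter (hl'.1 cs))
  · intro j
    have : (fun x => ((((if p x then l x else l' x))[j]?).map Prod.fst).getD 0)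
        = fun x => if p x then (((l x)[j]?).map Prod.fst).getD 0
            else (((l' x)[j]?).map Prod.fst).getD 0 := by
      ext x; by_cases hx : p x <;> simp [hx]
    rw [this]
    exact Measurable.ite hp (hl.2 j) (hl'.2 j)

lemma LogMeasurable.append {l : X → DownloadLog} (hl : LogMeasurable l) {t : X → ℝ}
    (ht : Measurable t) {A : X → Finset Chunk} (hA : ∀ B, MeasurableSet {x | A x = B}) :
    LogMeasurable fun x => l x ++ [(t x, A x)] := by
  constructor
  · intro cs
    have : {x | (l x ++ [(t x, A x)]).map Prod.snd = cs}
        = ⋃ B : Finset Chunk, {x | A x = B} ∩ {x | (l x).map Prod.snd ++ [B] = cs} := by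
      ext x; simp
    rw [this]
    exact MeasurableSet.iUnion fun B =>
      (hA B).inter (hl.measurableSet_pattern fun ds => ds ++ [B] = cs)
  · intro j
    have : (fun x => (((l x ++ [(t x, A x)])[j]?).map Prod.fst).getD 0)
        = fun x => if ((l x).map Prod.snd).length = j then t x
            else (((l x)[j]?).map Prod.fst).getD 0 := by
      ext x
      rw [List.length_map]
      rcases lt_trichotomy j (l x).length with h | h | h
      · rw [if_neg h.ne', List.getElem?_append_left h]
      · rw [if_pos h.symm, h]; simp
      · rw [if_neg h.ne, List.getElem?_eq_none (by simpa using h),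
          List.getElem?_eq_none h.le]
    rw [this]
    exact Measurable.ite (hl.measurableSet_pattern fun ds => ds.length = j) ht (hl.2 j)

variable {L : ℕ} (π : OnlinePolicy L) (req : ℕ → Request) (N : ℕ)

lemma measurableSet_serve_eq {u : X → unitInterval} (hu : Measurable u) {l : X → DownloadLog}
    (hl : LogMeasurable l) {v : X → ℝ} (hv : Measurable v) (arr : List Request)
    (A : Finset Chunk) : MeasurableSet {x | π.serve (u x) ⟨arr, l x, v x⟩ = A} := by
  have : {x | π.serve (u x) ⟨arr, l x, v x⟩ = A} = ⋃ cs : List (Finset Chunk),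
      {x | (l x).map Prod.snd = cs} ∩
        (fun x => (u x, (fun j : Fin cs.length => (((l x)[(j : ℕ)]?).map Prod.fst).getD 0, v x)))
          ⁻¹' {p : unitInterval × (Fin cs.length → ℝ) × ℝ |
            π.serve p.1 ⟨arr, List.ofFn (fun j => (p.2.1 j, cs.get j)), p.2.2⟩ = A} := by
    ext x
    -- A log is recovered from its pattern and its instants; the default 0 never occurs at these
    -- indices. On each of the countably many patterns, `measurable_serve` applies.
    have key : List.ofFn (fun j : Fin ((l x).map Prod.snd).length =>
        ((((l x)[(j : ℕ)]?).map Prod.fst).getD 0, ((l x).map Prod.snd).get j)) = l x := by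
      refine List.ext_getElem (by simp) fun i h1 h2 => ?_
      simp
    simp only [Set.mem_ofPred_eq, Set.mem_iUnion, Set.mem_inter_iff, Set.mem_preimage,
      exists_eq_left']
    rw [key]
  rw [this]
  refine MeasurableSet.iUnion fun cs => (hl.1 cs).inter ?_
  have hm : Measurable fun x => (u x, (fun j : Fin cs.length =>
      (((l x)[(j : ℕ)]?).map Prod.fst).getD 0, v x)) :=
    hu.prodMk ((measurable_pi_iff.2 fun j : Fin cs.length => hl.2 j).prodMk hv)
  exact hm (π.measurable_serve arr cs A)

/-- The chunks under service at time `v` when the log is `l`. -/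
noncomputable def served (u : unitInterval) (l : DownloadLog) (v : ℝ) : Finset Chunk :=
  π.serve u ⟨arrivedBy req N v, l, v⟩

/-- The list of arrived requests depends on the time only through a finite set of indices. Splitting
according to this set makes the list constant, as `measurable_serve` requires. -/
lemma arrivedBy_eq_of_filter (v : ℝ) :
    arrivedBy req N v = ((List.range N).filter fun i =>
      i ∈ (Finset.range N).filter fun i => (req i).arrival ≤ v).map req := by
  rw [arrivedBy, List.filter_map]
  congr 1
  refine List.filter_congr fun i hi => ?_
  simp [List.mem_range.1 hi]

lemma measurableSet_mem_served {u : X → unitInterval} (hu : Measurable u) {l : X → DownloadLog}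
    (hl : LogMeasurable l) {v : X → ℝ} (hv : Measurable v) (c : Chunk) :
    MeasurableSet {x | c ∈ served π req N (u x) (l x) (v x)} := by
  have : {x | c ∈ served π req N (u x) (l x) (v x)}
      = ⋃ (I ∈ (Finset.range N).powerset) (A : {A : Finset Chunk // c ∈ A}),
        {x | (Finset.range N).filter (fun i => (req i).arrival ≤ v x) = I} ∩
        {x | π.serve (u x) ⟨((List.range N).filter fun i => i ∈ I).map req, l x, v x⟩ = A.1} := by
    ext x
    simp only [Set.mem_ofPred_eq, Set.mem_iUnion, Set.mem_inter_iff, served,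
      arrivedBy_eq_of_filter]
    constructor
    · intro h
      exact ⟨_, Finset.mem_powerset.2 (Finset.filter_subset _ _), ⟨_, h⟩, rfl, rfl⟩
    · rintro ⟨I, -, ⟨A, hA⟩, rfl, h⟩
      rw [h]; exact hA
  rw [this]
  refine Finset.measurableSet_biUnion _ fun I hI => MeasurableSet.iUnion fun A =>
    MeasurableSet.inter ?_ (measurableSet_serve_eq π hu hl hv _ _)
  have : {x | (Finset.range N).filter (fun i => (req i).arrival ≤ v x) = I}
      = ⋂ i ∈ Finset.range N, {x | (req i).arrival ≤ v x ↔ i ∈ I} := by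
    ext x
    simp only [Set.mem_ofPred_eq, Set.mem_iInter, Finset.ext_iff, Finset.mem_filter]
    have := Finset.mem_powerset.1 hI
    constructor
    · intro h i hi
      rw [← h i]; tauto
    · intro h i
      constructor
      · rintro ⟨hi, h'⟩
        exact (h i hi).1 h'
      · intro hi
        exact ⟨this hi, (h i (this hi)).2 hi⟩
  rw [this]
  refine Finset.measurableSet_biInter _ fun i _ => ?_
  exact (measurableSet_le measurable_const hv).iff (MeasurableSet.const _)

/-- The state depends measurably on the sample point. -/
structure StateMeasurable (s : X → SystemState) : Prop where
  time : Measurable fun x => (s x).time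
  log : LogMeasurable fun x => (s x).log
  rem : Measurable fun x => (s x).rem

/-- The service time is the measure of a section of a set that is jointly measurable in the sample
point and the time. -/
lemma measurable_serviceTime {u : X → unitInterval} (hu : Measurable u) {s : X → SystemState}
    (hs : StateMeasurable s) {t : X → ℝ} (ht : Measurable t) (c : Chunk) :
    Measurable fun x => serviceTime π req N (u x) (s x) c (t x) := by
  refine ENNReal.measurable_toReal.comp ?_
  have hset : MeasurableSet {p : X × ℝ | ((s p.1).time < p.2 ∧ p.2 ≤ t p.1) ∧
      c ∈ served π req N (u p.1) (s p.1).log p.2} := by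
    refine MeasurableSet.inter (MeasurableSet.inter
      (measurableSet_lt (hs.time.comp measurable_fst) measurable_snd)
      (measurableSet_le measurable_snd (ht.comp measurable_fst))) ?_
    exact measurableSet_mem_served π req N (hu.comp measurable_fst) (hs.log.comp measurable_fst)
      measurable_snd c
  exact measurable_measure_prodMk_left hset

end Measurability

/-! ### Cumulated service of a chunk while the log is fixed -/

section Service

variable {L : ℕ} (π : OnlinePolicy L) (req : ℕ → Request) (N : ℕ) (u : unitInterval)

/-- The rate at which chunk `c` is served when the log is `l`. -/
noncomputable def serviceRate (l : DownloadLog) (c : Chunk) : ℝ → ℝ≥0∞ :=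
  {v : ℝ | c ∈ served π req N u l v}.indicator 1

lemma measurableSet_served (l : DownloadLog) (c : Chunk) :
    MeasurableSet {v : ℝ | c ∈ served π req N u l v} :=
  measurableSet_mem_served π req N measurable_const (logMeasurable_const l) measurable_id c

lemma volume_inter_ne_top (s t : ℝ) (B : Set ℝ) : volume (Set.Ioc s t ∩ B) ≠ ∞ :=
  measure_ne_top_of_subset Set.inter_subset_left (by simp)

lemma serviceTime_eq (s : SystemState) (c : Chunk) (t : ℝ) : serviceTime π req N u s c t
    = (volume (Set.Ioc s.time t ∩ {v : ℝ | c ∈ served π req N u s.log v})).toReal := rfl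

lemma serviceTime_nonneg (s : SystemState) (c : Chunk) (t : ℝ) :
    0 ≤ serviceTime π req N u s c t := ENNReal.toReal_nonneg

lemma serviceTime_mono (s : SystemState) (c : Chunk) : Monotone (serviceTime π req N u s c) := by
  intro t t' h
  exact ENNReal.toReal_mono (volume_inter_ne_top _ _ _)
    (measure_mono (Set.inter_subset_inter_left _ (Set.Ioc_subset_Ioc_right h)))

/-- The remaining downloading times `r` are arbitrary, because the service depends only on the time
and the log of a state. -/
lemma serviceTime_split (s : SystemState) (c : Chunk) {t₁ t : ℝ} (h₁ : s.time ≤ t₁)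
    (h : t₁ ≤ t) (r : Chunk → ℝ) :
    serviceTime π req N u s c t
      = serviceTime π req N u s c t₁ + serviceTime π req N u ⟨t₁, s.log, r⟩ c t := by
  rw [serviceTime_eq, serviceTime_eq, serviceTime_eq,
    ← ENNReal.toReal_add (volume_inter_ne_top _ _ _) (volume_inter_ne_top _ _ _),
    ← measure_union]
  · rw [← Set.union_inter_distrib_right, Set.Ioc_union_Ioc_eq_Ioc h₁ h]
  · rw [Set.disjoint_left]
    rintro z ⟨hz, -⟩ ⟨hz', -⟩
    exact absurd hz.2 (not_le.2 hz'.1)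
  · exact measurableSet_Ioc.inter (measurableSet_served π req N u _ c)

lemma serviceTime_of_le (s : SystemState) (c : Chunk) {t : ℝ} (h : t ≤ s.time) :
    serviceTime π req N u s c t = 0 := by
  rw [serviceTime_eq, Set.Ioc_eq_empty (not_lt.2 h)]
  simp

lemma serviceTime_le_add (s : SystemState) (c : Chunk) {t t' : ℝ} (h : t ≤ t') :
    serviceTime π req N u s c t' ≤ serviceTime π req N u s c t + (t' - t) := by
  rw [serviceTime_eq, serviceTime_eq, ← ENNReal.toReal_ofReal (sub_nonneg.2 h),
    ← ENNReal.toReal_add (volume_inter_ne_top _ _ _) ENNReal.ofReal_ne_top, ← Real.volume_Ioc]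
  refine ENNReal.toReal_mono (ENNReal.add_ne_top.2 ⟨volume_inter_ne_top _ _ _, by simp⟩) ?_
  refine (measure_mono ?_).trans (measure_union_le _ _)
  rintro z ⟨hz, hz'⟩
  by_cases hzt : z ≤ t
  · exact Or.inl ⟨⟨hz.1, hzt⟩, hz'⟩
  · exact Or.inr ⟨not_le.1 hzt, hz.2⟩

lemma continuous_serviceTime (s : SystemState) (c : Chunk) :
    Continuous (serviceTime π req N u s c) := by
  refine (LipschitzWith.of_le_add fun t' t => ?_).continuous
  rcases le_total t t' with h | h
  · rw [Real.dist_eq, abs_of_nonneg (sub_nonneg.2 h)]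
    exact serviceTime_le_add π req N u s c h
  · exact (serviceTime_mono π req N u s c h).trans (le_add_of_nonneg_right dist_nonneg)

lemma isCumulative_serviceTime (s : SystemState) (c : Chunk) :
    IsCumulative s.time (serviceRate π req N u s.log c) (serviceTime π req N u s c) where
  monotone := serviceTime_mono π req N u s c
  continuous := continuous_serviceTime π req N u s c
  zero := serviceTime_of_le π req N u s c le_rfl
  measurable := measurable_one.indicator (measurableSet_served π req N u _ c)
  lintegral t _ := by
    rw [serviceRate, lintegral_indicator_one (measurableSet_served π req N u _ c),
      Measure.restrict_apply (measurableSet_served π req N u _ c), Set.inter_comm,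
      serviceTime_eq, ENNReal.ofReal_toReal (volume_inter_ne_top _ _ _)]

end Service

/-! ### Completions along a run, and restarting it -/

section Run

variable {L : ℕ} (π : OnlinePolicy L) (req : ℕ → Request) (N : ℕ) (u : unitInterval)

lemma isClosed_completionInstants (s : SystemState) :
    IsClosed (completionInstants π req N u s) := by
  have : completionInstants π req N u s = Set.Ici s.time ∩
      ⋃ c ∈ allChunks req N \ downloaded s.log, {t | s.rem c ≤ serviceTime π req N u s c t} := by
    ext t; simp [completionInstants]
  rw [this]
  exact isClosed_Ici.inter (isClosed_biUnion_finset fun c _ =>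
    isClosed_le continuous_const (continuous_serviceTime π req N u s c))

lemma bddBelow_completionInstants (s : SystemState) :
    BddBelow (completionInstants π req N u s) := ⟨s.time, fun _ ht => ht.1⟩

lemma completionInstants_mono (s : SystemState) {t t' : ℝ} (h : t ≤ t')
    (ht : t ∈ completionInstants π req N u s) : t' ∈ completionInstants π req N u s := by
  obtain ⟨h1, c, hc, h2⟩ := ht
  exact ⟨h1.trans h, c, hc, h2.trans (serviceTime_mono π req N u s c h)⟩

lemma sInf_completionInstants_le_iff {s : SystemState}
    (hne : (completionInstants π req N u s).Nonempty) (t : ℝ) :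
    sInf (completionInstants π req N u s) ≤ t ↔ t ∈ completionInstants π req N u s :=
  ⟨fun h => completionInstants_mono π req N u s h
    ((isClosed_completionInstants π req N u s).csInf_mem hne
      (bddBelow_completionInstants π req N u s)),
   fun h => csInf_le (bddBelow_completionInstants π req N u s) h⟩

lemma le_time_nextState (s : SystemState) : s.time ≤ (nextState π req N u s).time := by
  rw [nextState]
  split_ifs with h
  · exact le_csInf h fun t ht => ht.1
  · exact le_rfl

lemma downloaded_subset_nextState (s : SystemState) :
    downloaded s.log ⊆ downloaded (nextState π req N u s).log := by
  rw [nextState]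
  split_ifs with h
  · simp only [downloaded_append]
    exact Finset.subset_union_left
  · exact subset_rfl

lemma numDownloaded_mono {l l' : DownloadLog} (h : downloaded l ⊆ downloaded l') (i : ℕ) :
    numDownloaded l i ≤ numDownloaded l' i :=
  Finset.card_le_card (Finset.filter_subset_filter _ h)

/-- In the run from state `s`, request `i` is completed by time `K`. -/
def CompletedBy (s : SystemState) (K : ℝ) (i : ℕ) : Prop :=
  ∃ m, (req i).k ≤ numDownloaded ((nextState π req N u)^[m] s).log i ∧
    ((nextState π req N u)^[m] s).time ≤ K

lemma completedBy_iff (s : SystemState) (K : ℝ) (i : ℕ) :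
    CompletedBy π req N u s K i ↔ ((req i).k ≤ numDownloaded s.log i ∧ s.time ≤ K) ∨
      CompletedBy π req N u (nextState π req N u s) K i := by
  constructor
  · rintro ⟨m, hm⟩
    cases m with
    | zero => exact Or.inl hm
    | succ m => exact Or.inr ⟨m, hm⟩
  · rintro (h | ⟨m, hm⟩)
    · exact ⟨0, h⟩
    · exact ⟨m + 1, hm⟩

lemma le_time_iterate (s : SystemState) (m : ℕ) :
    s.time ≤ ((nextState π req N u)^[m] s).time := by
  induction m generalizing s with
  | zero => exact le_rfl
  | succ m ih => exact (le_time_nextState π req N u s).trans (ih _)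

lemma nextState_of_isEmpty {s : SystemState}
    (h : ¬ (completionInstants π req N u s).Nonempty) : nextState π req N u s = s := by
  rw [nextState, if_neg h]

lemma completedBy_of_isEmpty {s : SystemState}
    (h : ¬ (completionInstants π req N u s).Nonempty) (K : ℝ) (i : ℕ) :
    CompletedBy π req N u s K i ↔ (req i).k ≤ numDownloaded s.log i ∧ s.time ≤ K := by
  constructor
  · rintro ⟨m, hm⟩
    rwa [Function.iterate_fixed (nextState_of_isEmpty π req N u h)] at hm
  · exact fun h => ⟨0, h⟩

/-- The requests that are complete by time `K` are complete at once if there is no completion of a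
download up to time `K`. -/
lemma completedBy_of_notMem {s : SystemState} {K : ℝ} (hK : s.time ≤ K)
    (h : K ∉ completionInstants π req N u s) (i : ℕ) :
    CompletedBy π req N u s K i ↔ (req i).k ≤ numDownloaded s.log i := by
  by_cases hne : (completionInstants π req N u s).Nonempty
  · rw [completedBy_iff]
    constructor
    · rintro (h' | ⟨m, -, hm⟩)
      · exact h'.1
      · exfalso
        have h1 := (le_time_iterate π req N u (nextState π req N u s) m).trans hm
        rw [nextState, if_pos hne] at h1
        exact h ((sInf_completionInstants_le_iff π req N u hne K).1 h1)
    · exact fun h' => Or.inl ⟨h', hK⟩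
  · rw [completedBy_of_isEmpty π req N u hne]
    tauto

/-- Up to the first completion of a download, the run may be restarted at any time. -/
lemma completedBy_restart {s : SystemState} {t K : ℝ} (ht : s.time ≤ t) (hK : t ≤ K)
    (h : t ∉ completionInstants π req N u s) (i : ℕ) :
    CompletedBy π req N u s K i ↔ CompletedBy π req N u
      ⟨t, s.log, fun c => s.rem c - serviceTime π req N u s c t⟩ K i := by
  set s' : SystemState := ⟨t, s.log, fun c => s.rem c - serviceTime π req N u s c t⟩ with hs'
  have hsplit : ∀ c t', t ≤ t' → serviceTime π req N u s c t'
      = serviceTime π req N u s c t + serviceTime π req N u s' c t' :=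
    fun c t' ht' => serviceTime_split π req N u s c ht ht' _
  -- Nothing completes up to `t`, and from `t` on both the requirement of a chunk and the service
  -- counted towards it are reduced by the same amount.
  have hCI : completionInstants π req N u s' = completionInstants π req N u s := by
    ext t'
    constructor
    · rintro ⟨h1, c, hc, h2⟩
      have h1' : t ≤ t' := h1
      refine ⟨ht.trans h1, c, hc, ?_⟩
      have := hsplit c t' h1
      simp only [hs'] at h2
      simp only [hs'] at this
      linarith
    · rintro ⟨h1, c, hc, h2⟩
      have h1' : t ≤ t' := by
        by_contra hlt
        exact h (completionInstants_mono π req N u s (not_le.1 hlt).le ⟨h1, c, hc, h2⟩)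
      refine ⟨h1', c, hc, ?_⟩
      have := hsplit c t' h1'
      simp only [hs'] at this
      simp only [hs']
      linarith
  by_cases hne : (completionInstants π req N u s).Nonempty
  · have hnext : nextState π req N u s' = nextState π req N u s := by
      rw [nextState, nextState, if_pos hne, if_pos (by rwa [hCI]), hCI]
      set t' := sInf (completionInstants π req N u s) with ht'
      have htt' : t ≤ t' := by
        by_contra hlt
        exact h ((sInf_completionInstants_le_iff π req N u hne t).1 (not_le.1 hlt).le)
      have hrem : ∀ c, s'.rem c - serviceTime π req N u s' c t'
          = s.rem c - serviceTime π req N u s c t' := by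
        intro c
        rw [hsplit c t' htt']
        simp only [hs']
        ring
      have hle : ∀ c, s'.rem c ≤ serviceTime π req N u s' c t'
          ↔ s.rem c ≤ serviceTime π req N u s c t' := by
        intro c
        rw [← sub_nonpos, hrem, sub_nonpos]
      simp only [hrem, hle]
      rfl
    rw [completedBy_iff, completedBy_iff π req N u s', hnext]
    have : s.time ≤ K ↔ s'.time ≤ K := iff_of_true (ht.trans hK) hK
    rw [this]
  · rw [completedBy_of_isEmpty π req N u hne, completedBy_of_isEmpty π req N u (by rwa [hCI])]
    have : s.time ≤ K ↔ s'.time ≤ K := iff_of_true (ht.trans hK) hK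
    rw [this]

lemma completedBy_nextState {s : SystemState} {K : ℝ} (hK : (nextState π req N u s).time ≤ K)
    (i : ℕ) : CompletedBy π req N u s K i
      ↔ CompletedBy π req N u (nextState π req N u s) K i := by
  rw [completedBy_iff]
  refine or_iff_right_of_imp fun h => ⟨0, ?_, hK⟩
  exact h.1.trans (numDownloaded_mono (downloaded_subset_nextState π req N u s) i)

/-- Equality of states as far as the future is concerned. -/
def SameFuture (s s' : SystemState) : Prop :=
  s.time = s'.time ∧ s.log = s'.log ∧
    ∀ c ∈ allChunks req N \ downloaded s.log, s.rem c = s'.rem c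

/-- The dynamics consult the remaining times of existing chunks that are not yet downloaded and no
others. Hence the coordinate of a chunk that has just completed may be replaced by a fresh variable.
-/
lemma SameFuture.nextState {s s' : SystemState} (h : SameFuture req N s s') :
    SameFuture req N (nextState π req N u s) (nextState π req N u s') := by
  obtain ⟨t, l, r⟩ := s
  obtain ⟨t', l', r'⟩ := s'
  obtain ⟨h1, h2, h3⟩ := h
  simp only at h1 h2 h3
  subst h1 h2
  have hserv : ∀ c v, serviceTime π req N u ⟨t, l, r⟩ c v = serviceTime π req N u ⟨t, l, r'⟩ c v :=
    fun _ _ => rfl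
  have hCI : completionInstants π req N u ⟨t, l, r⟩ = completionInstants π req N u ⟨t, l, r'⟩ := by
    ext v
    simp only [completionInstants, Set.mem_ofPred_eq]
    refine and_congr_right fun _ => exists_congr fun c => and_congr_right fun hc => ?_
    rw [h3 c hc, hserv]
  rw [CloudStorage.nextState, CloudStorage.nextState, hCI]
  split_ifs with hne
  · refine ⟨rfl, ?_, ?_⟩
    · simp only
      congr 3
      refine Finset.filter_congr fun c hc => ?_
      rw [h3 c hc, hserv]
    · intro c hc
      simp only [downloaded_append] at hc ⊢
      rw [hserv, h3 c]
      simp only [Finset.mem_sdiff, Finset.mem_union] at hc ⊢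
      tauto
  · exact ⟨rfl, rfl, h3⟩

lemma SameFuture.completedBy {s s' : SystemState} (h : SameFuture req N s s') (K : ℝ) (i : ℕ) :
    CompletedBy π req N u s K i ↔ CompletedBy π req N u s' K i := by
  have hit : ∀ m, SameFuture req N ((CloudStorage.nextState π req N u)^[m] s)
      ((CloudStorage.nextState π req N u)^[m] s') := by
    intro m
    induction m with
    | zero => exact h
    | succ m ih =>
      rw [Function.iterate_succ_apply', Function.iterate_succ_apply']
      exact ih.nextState π req N u
  refine exists_congr fun m => ?_
  rw [(hit m).1, (hit m).2.1]

end Run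

/-! ### Measurability of the run -/

section RunMeasurability

variable {X : Type*} [MeasurableSpace X] {L : ℕ} (π : OnlinePolicy L) (req : ℕ → Request) (N : ℕ)

lemma measurableSet_mem_completionInstants {u : X → unitInterval} (hu : Measurable u)
    {s : X → SystemState} (hs : StateMeasurable s) {t : X → ℝ} (ht : Measurable t) :
    MeasurableSet {x | t x ∈ completionInstants π req N (u x) (s x)} := by
  have : {x | t x ∈ completionInstants π req N (u x) (s x)} = {x | (s x).time ≤ t x} ∩
      ⋃ c ∈ allChunks req N, {x | c ∉ downloaded (s x).log} ∩
        {x | (s x).rem c ≤ serviceTime π req N (u x) (s x) c (t x)} := by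
    ext x
    simp only [completionInstants, Set.mem_ofPred_eq, Set.mem_inter_iff, Set.mem_iUnion,
      Finset.mem_sdiff, exists_prop, and_assoc]
  rw [this]
  refine (measurableSet_le hs.time ht).inter (Finset.measurableSet_biUnion _ fun c _ => ?_)
  exact (hs.log.measurableSet_downloaded fun D => c ∉ D).inter
    (measurableSet_le ((measurable_pi_apply c).comp hs.rem)
      (measurable_serviceTime π req N hu hs ht c))

lemma measurableSet_completionInstants_nonempty {u : X → unitInterval} (hu : Measurable u)
    {s : X → SystemState} (hs : StateMeasurable s) :
    MeasurableSet {x | (completionInstants π req N (u x) (s x)).Nonempty} := by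
  -- The set of completion instants is closed upwards, so integer offsets suffice as test times.
  have : {x | (completionInstants π req N (u x) (s x)).Nonempty}
      = ⋃ n : ℕ, {x | (s x).time + n ∈ completionInstants π req N (u x) (s x)} := by
    ext x
    simp only [Set.mem_ofPred_eq, Set.mem_iUnion]
    constructor
    · rintro ⟨t, ht⟩
      obtain ⟨n, hn⟩ := exists_nat_ge (t - (s x).time)
      exact ⟨n, completionInstants_mono π req N (u x) (s x) (by linarith) ht⟩
    · rintro ⟨n, hn⟩
      exact ⟨_, hn⟩
  rw [this]
  exact MeasurableSet.iUnion fun n =>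
    measurableSet_mem_completionInstants π req N hu hs (hs.time.add_const _)

lemma measurable_sInf_completionInstants {u : X → unitInterval} (hu : Measurable u)
    {s : X → SystemState} (hs : StateMeasurable s) :
    Measurable fun x => sInf (completionInstants π req N (u x) (s x)) := by
  refine measurable_of_Iic fun t => ?_
  -- The second piece reflects the convention that the infimum of the empty set is 0.
  have : (fun x => sInf (completionInstants π req N (u x) (s x))) ⁻¹' Set.Iic t
      = ({x | (completionInstants π req N (u x) (s x)).Nonempty}
          ∩ {x | t ∈ completionInstants π req N (u x) (s x)})
        ∪ ({x | (completionInstants π req N (u x) (s x)).Nonempty}ᶜ ∩ {_x | 0 ≤ t}) := by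
    ext x
    by_cases hne : (completionInstants π req N (u x) (s x)).Nonempty
    · simp [hne, sInf_completionInstants_le_iff π req N (u x) hne]
    · simp [Set.not_nonempty_iff_eq_empty.1 hne]
  rw [this]
  have hB := measurableSet_completionInstants_nonempty π req N hu hs
  exact (hB.inter (measurableSet_mem_completionInstants π req N hu hs measurable_const)).union
    (hB.compl.inter (MeasurableSet.const _))

open Classical in
lemma StateMeasurable.nextState {u : X → unitInterval} (hu : Measurable u)
    {s : X → SystemState} (hs : StateMeasurable s) :
    StateMeasurable fun x => nextState π req N (u x) (s x) := by
  have hB := measurableSet_completionInstants_nonempty π req N hu hs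
  have ht := measurable_sInf_completionInstants π req N hu hs
  have e1 : (fun x => (CloudStorage.nextState π req N (u x) (s x)).time)
      = fun x => if (completionInstants π req N (u x) (s x)).Nonempty
        then sInf (completionInstants π req N (u x) (s x)) else (s x).time := by
    ext x; rw [CloudStorage.nextState]; split_ifs <;> rfl
  have e2 : (fun x => (CloudStorage.nextState π req N (u x) (s x)).log)
      = fun x => if (completionInstants π req N (u x) (s x)).Nonempty
        then (s x).log ++ [(sInf (completionInstants π req N (u x) (s x)),
          (allChunks req N \ downloaded (s x).log).filter (fun c => (s x).rem c ≤
            serviceTime π req N (u x) (s x) c (sInf (completionInstants π req N (u x) (s x)))))]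
        else (s x).log := by
    ext1 x; rw [CloudStorage.nextState]; split_ifs <;> rfl
  have e3 : (fun x => (CloudStorage.nextState π req N (u x) (s x)).rem)
      = fun x => if (completionInstants π req N (u x) (s x)).Nonempty
        then fun c => (s x).rem c -
            serviceTime π req N (u x) (s x) c (sInf (completionInstants π req N (u x) (s x)))
        else (s x).rem := by
    ext1 x; rw [CloudStorage.nextState]; split_ifs <;> rfl
  refine ⟨?_, ?_, ?_⟩
  · rw [e1]
    exact Measurable.ite hB ht hs.time
  · rw [e2]
    refine LogMeasurable.ite (hs.log.append ht fun D => ?_) hs.log hB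
    have : {x | (allChunks req N \ downloaded (s x).log).filter (fun c => (s x).rem c ≤
            serviceTime π req N (u x) (s x) c (sInf (completionInstants π req N (u x) (s x)))) = D}
        = {_x | D ⊆ allChunks req N} ∩ ⋂ c ∈ allChunks req N,
          {x | (c ∉ downloaded (s x).log ∧ (s x).rem c ≤ serviceTime π req N (u x) (s x) c
            (sInf (completionInstants π req N (u x) (s x)))) ↔ c ∈ D} := by
      ext x
      simp only [Set.mem_ofPred_eq, Set.mem_inter_iff, Set.mem_iInter, Finset.ext_iff,
        Finset.mem_filter, Finset.mem_sdiff, and_assoc]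
      constructor
      · intro h
        refine ⟨fun c hc => ((h c).2 hc).1, fun c hc => ?_⟩
        rw [← h c]; tauto
      · rintro ⟨hD, h⟩ c
        constructor
        · rintro ⟨hc, h'⟩
          exact (h c hc).1 h'
        · intro hc
          exact ⟨hD hc, (h c (hD hc)).2 hc⟩
    rw [this]
    refine (MeasurableSet.const _).inter (Finset.measurableSet_biInter _ fun c _ => ?_)
    refine MeasurableSet.iff (MeasurableSet.inter
      (hs.log.measurableSet_downloaded fun D => c ∉ D) ?_) (MeasurableSet.const _)
    exact measurableSet_le ((measurable_pi_apply c).comp hs.rem)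
      (measurable_serviceTime π req N hu hs ht c)
  · rw [e3]
    refine Measurable.ite hB (measurable_pi_iff.2 fun c => ?_) hs.rem
    exact ((measurable_pi_apply c).comp hs.rem).sub (measurable_serviceTime π req N hu hs ht c)

lemma StateMeasurable.iterate {u : X → unitInterval} (hu : Measurable u)
    {s : X → SystemState} (hs : StateMeasurable s) (m : ℕ) :
    StateMeasurable fun x => (CloudStorage.nextState π req N (u x))^[m] (s x) := by
  induction m with
  | zero => exact hs
  | succ m ih =>
    simp only [Function.iterate_succ_apply']
    exact ih.nextState π req N hu

lemma LogMeasurable.measurableSet_numDownloaded {l : X → DownloadLog} (hl : LogMeasurable l)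
    (k i : ℕ) : MeasurableSet {x | k ≤ numDownloaded (l x) i} :=
  hl.measurableSet_downloaded fun D => k ≤ (D.filter fun c => c.1 = i).card

lemma measurableSet_completedBy {u : X → unitInterval} (hu : Measurable u)
    {s : X → SystemState} (hs : StateMeasurable s) {K : X → ℝ} (hK : Measurable K) (i : ℕ) :
    MeasurableSet {x | CompletedBy π req N (u x) (s x) (K x) i} := by
  have : {x | CompletedBy π req N (u x) (s x) (K x) i} = ⋃ m : ℕ,
      {x | (req i).k ≤ numDownloaded ((CloudStorage.nextState π req N (u x))^[m] (s x)).log i} ∩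
      {x | ((CloudStorage.nextState π req N (u x))^[m] (s x)).time ≤ K x} := by
    ext x; simp [CompletedBy]
  rw [this]
  exact MeasurableSet.iUnion fun m => ((hs.iterate π req N hu m).log.measurableSet_numDownloaded
    _ _).inter (measurableSet_le (hs.iterate π req N hu m).time hK)

end RunMeasurability

/-! ### What SERPT-R serves under high redundancy -/

section Observations

variable {req : ℕ → Request} {N : ℕ}

/-- As arrival times are monotone, the arrived requests form an initial segment, so positions in the
observed list are the true request numbers. -/
lemma arrivedBy_getElem? (hmono : ∀ i j, i ≤ j → j < N → (req i).arrival ≤ (req j).arrival)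
    (v : ℝ) (i : ℕ) : (arrivedBy req N v)[i]?
      = if i < N ∧ (req i).arrival ≤ v then some (req i) else none := by
  induction N with
  | zero => simp [arrivedBy]
  | succ N ih =>
    have ih := ih fun i j hij hj => hmono i j hij (hj.trans (Nat.lt_succ_self N))
    have hsucc : arrivedBy req (N + 1) v
        = arrivedBy req N v ++ if (req N).arrival ≤ v then [req N] else [] := by
      rw [arrivedBy, List.range_succ, List.map_append, List.filter_append]
      by_cases h : (req N).arrival ≤ v <;> simp [arrivedBy, h]
    rw [hsucc]
    by_cases h : (req N).arrival ≤ v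
    · have hall : arrivedBy req N v = (List.range N).map req := by
        rw [arrivedBy, List.filter_eq_self]
        intro r hr
        obtain ⟨j, hj, rfl⟩ := List.mem_map.1 hr
        have := hmono j N (List.mem_range.1 hj).le (Nat.lt_succ_self N)
        simpa using this.trans h
      have hlen : (arrivedBy req N v).length = N := by rw [hall]; simp
      rw [if_pos h]
      rcases lt_trichotomy i N with hi | hi | hi
      · rw [List.getElem?_append_left (by rwa [hlen]), ih]
        simp [hi, hi.trans (Nat.lt_succ_self N)]
      · subst hi
        rw [List.getElem?_append_right hlen.le, hlen]
        simp [h]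
      · rw [List.getElem?_eq_none (by
          simp only [List.length_append, List.length_cons, List.length_nil, hlen]; omega), if_neg (by omega)]
    · rw [if_neg h, List.append_nil, ih]
      rcases eq_or_ne i N with rfl | hi
      · simp [h]
      · have : i < N + 1 ↔ i < N := by omega
        simp [this]

variable (req N) in
/-- The requests that have arrived by time `v`. -/
noncomputable def arrivedSet (v : ℝ) : Finset ℕ :=
  (Finset.range N).filter fun i => (req i).arrival ≤ v

variable (req) in
/-- The number of chunks of request `i` that still have to be downloaded. -/
def numRemaining (l : DownloadLog) (i : ℕ) : ℕ := (req i).k - numDownloaded l i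

lemma mem_arrivedSet {v : ℝ} {i : ℕ} : i ∈ arrivedSet req N v ↔ i < N ∧ (req i).arrival ≤ v := by
  simp [arrivedSet]

lemma arrivedSet_mono {v w : ℝ} (h : v ≤ w) : arrivedSet req N v ⊆ arrivedSet req N w := by
  intro i hi
  rw [mem_arrivedSet] at hi ⊢
  exact ⟨hi.1, hi.2.trans h⟩

variable (hmono : ∀ i j, i ≤ j → j < N → (req i).arrival ≤ (req j).arrival)
include hmono

lemma unfinished_iff {l : DownloadLog} {v : ℝ} {i : ℕ} :
    (⟨arrivedBy req N v, l, v⟩ : Observation).Unfinished i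
      ↔ i ∈ arrivedSet req N v ∧ 0 < numRemaining req l i := by
  rw [Observation.Unfinished, mem_arrivedSet]
  simp only [arrivedBy_getElem? hmono, numRemaining, Nat.sub_pos_iff_lt]
  by_cases h : i < N ∧ (req i).arrival ≤ v <;> simp [h]

lemma remaining_eq {l : DownloadLog} {v : ℝ} {i : ℕ} (hi : i ∈ arrivedSet req N v) :
    (⟨arrivedBy req N v, l, v⟩ : Observation).remaining i = numRemaining req l i := by
  simp only [Observation.remaining, arrivedBy_getElem? hmono, if_pos (mem_arrivedSet.1 hi)]
  rfl

lemma available_eq {l : DownloadLog} {v : ℝ} {i : ℕ} (hi : i ∈ arrivedSet req N v) :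
    (⟨arrivedBy req N v, l, v⟩ : Observation).available i
      = ({i} ×ˢ Finset.range (req i).n) \ downloaded l := by
  simp only [Observation.available, arrivedBy_getElem? hmono, if_pos (mem_arrivedSet.1 hi)]

lemma mem_served {L : ℕ} {π : OnlinePolicy L} {u : unitInterval} {l : DownloadLog} {v : ℝ}
    {c : Chunk} (hc : c ∈ served π req N u l v) :
    c.1 ∈ arrivedSet req N v ∧ 0 < numRemaining req l c.1 ∧
      c ∈ allChunks req N \ downloaded l := by
  obtain ⟨h1, h2⟩ := π.feasible _ _ c hc
  obtain ⟨h3, h4⟩ := (unfinished_iff hmono).1 h1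
  refine ⟨h3, h4, ?_⟩
  rw [available_eq hmono h3] at h2
  rw [Finset.mem_sdiff] at h2 ⊢
  refine ⟨?_, h2.2⟩
  rw [allChunks, Finset.mem_biUnion]
  exact ⟨c.1, Finset.mem_range.2 (mem_arrivedSet.1 h3).1, h2.1⟩

omit hmono in
lemma numRemaining_append {l : DownloadLog} {c : Chunk} (hc : c ∉ downloaded l) (t : ℝ) :
    numRemaining req (l ++ [(t, {c})])
      = Function.update (numRemaining req l) c.1 (numRemaining req l c.1 - 1) := by
  have hd : ∀ i, numDownloaded (l ++ [(t, {c})]) i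
      = numDownloaded l i + if c.1 = i then 1 else 0 := by
    intro i
    rw [numDownloaded, downloaded_append, Finset.filter_union, Finset.card_union_of_disjoint,
      numDownloaded, Finset.filter_singleton]
    · congr 1
      split_ifs <;> simp
    · refine Finset.disjoint_filter_filter (Finset.disjoint_singleton_right.2 hc)
  ext i
  rw [numRemaining, hd]
  by_cases hi : i = c.1
  · subst hi
    rw [Function.update_self, if_pos rfl, numRemaining, Nat.sub_sub]
  · rw [Function.update_of_ne hi, if_neg (Ne.symm hi), numRemaining, add_zero]

variable {L : ℕ} (hk : ∀ i < N, (req i).k ≤ (req i).n) (hd : ∀ i < N, L ≤ (req i).dist)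
include hk hd

/-- Under high redundancy, an unfinished request has enough available chunks for all threads. -/
lemma le_card_available {l : DownloadLog} {v : ℝ} {i : ℕ} (hi : i ∈ arrivedSet req N v)
    (hpos : 0 < numRemaining req l i) :
    L ≤ ((⟨arrivedBy req N v, l, v⟩ : Observation).available i).card := by
  rw [available_eq hmono hi]
  have hN := (mem_arrivedSet.1 hi).1
  have h1 : ({i} ×ˢ Finset.range (req i).n) \ downloaded l
      = ({i} ×ˢ Finset.range (req i).n) \ (downloaded l).filter fun c => c.1 = i := by
    ext c
    simp only [Finset.mem_sdiff, Finset.mem_product, Finset.mem_singleton, Finset.mem_filter]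
    tauto
  have h2 := Finset.le_card_sdiff ((downloaded l).filter fun c => c.1 = i)
    ({i} ×ˢ Finset.range (req i).n : Finset Chunk)
  rw [← h1, Finset.card_product, Finset.card_singleton, Finset.card_range, one_mul] at h2
  -- Fewer than k chunks of the request have been downloaded, so at least n - k + 1 = d ≥ L are
  -- left.
  have h3 := hd i hN
  have h4 := hk i hN
  rw [numRemaining] at hpos
  rw [numDownloaded] at hpos
  rw [Request.dist] at h3
  omega

/-- One unfinished request alone has enough available chunks to occupy all threads, so an idle
thread means that none is left. -/
lemma numRemaining_eq_zero_of_idle {σ : OnlinePolicy L} (hσ : σ.IsSERPTR) {u : unitInterval}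
    {l : DownloadLog} {v : ℝ} (hidle : (served σ req N u l v).card < L) {i : ℕ}
    (hi : i ∈ arrivedSet req N v) : numRemaining req l i = 0 := by
  by_contra hne
  have hpos := Nat.pos_of_ne_zero hne
  have h1 := hσ.no_idle u ⟨arrivedBy req N v, l, v⟩ hidle i ((unfinished_iff hmono).2 ⟨hi, hpos⟩)
  have h2 := le_card_available hmono hk hd hi hpos
  exact absurd (h2.trans (Finset.card_le_card h1)) (not_le.2 hidle)

/-- Otherwise the priority rule would put the at least L available chunks of request `i` under
service in addition to `c`, which exceeds L threads. -/
lemma numRemaining_le_of_mem_served {σ : OnlinePolicy L} (hσ : σ.IsSERPTR) {u : unitInterval}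
    {l : DownloadLog} {v : ℝ} {c : Chunk} (hc : c ∈ served σ req N u l v) {i : ℕ}
    (hi : i ∈ arrivedSet req N v) (hpos : 0 < numRemaining req l i) :
    numRemaining req l c.1 ≤ numRemaining req l i := by
  by_contra hlt
  have hcm := mem_served hmono hc
  have h1 := hσ.priority u ⟨arrivedBy req N v, l, v⟩ c hc i
    ((unfinished_iff hmono).2 ⟨hi, hpos⟩)
    (by rw [remaining_eq hmono hi, remaining_eq hmono hcm.1]; exact not_le.1 hlt)
  have h2 := le_card_available hmono hk hd hi hpos
  have h3 : c ∉ (⟨arrivedBy req N v, l, v⟩ : Observation).available i := by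
    rw [available_eq hmono hi]
    simp only [Finset.mem_sdiff, Finset.mem_product, Finset.mem_singleton, not_and]
    rintro ⟨hci, -⟩
    rw [hci] at hlt
    exact absurd le_rfl hlt
  have h4 := Finset.card_le_card (Finset.insert_subset hc h1)
  rw [Finset.card_insert_of_notMem h3] at h4
  have h5 : (served σ req N u l v).card ≤ L := σ.card_le u ⟨arrivedBy req N v, l, v⟩
  omega

end Observations

/-! ### Recursion for the expected number of late requests -/

section Step

variable {L : ℕ} (π : OnlinePolicy L) (req : ℕ → Request) (N : ℕ) (u : unitInterval)

open Classical in
/-- The number of requests that are not completed by time `K` in the run from state `s`. -/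
noncomputable def numLate (K : ℝ) (s : SystemState) : ℝ≥0∞ :=
  (((Finset.range N).filter fun i => ¬ CompletedBy π req N u s K i).card : ℝ≥0∞)

/-- The number of requests that are not complete according to the log. -/
def numIncomplete (l : DownloadLog) : ℕ :=
  ((Finset.range N).filter fun i => 0 < numRemaining req l i).card

lemma numLate_congr {K : ℝ} {s s' : SystemState}
    (h : ∀ i, CompletedBy π req N u s K i ↔ CompletedBy π req N u s' K i) :
    numLate π req N u K s = numLate π req N u K s' := by
  classical
  rw [numLate, numLate]
  congr 2
  exact Finset.filter_congr fun i _ => not_congr (h i)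

lemma numLate_of_notMem {s : SystemState} {K : ℝ} (hK : s.time ≤ K)
    (h : K ∉ completionInstants π req N u s) :
    numLate π req N u K s = numIncomplete req N s.log := by
  classical
  rw [numLate, numIncomplete]
  congr 2
  refine Finset.filter_congr fun i _ => ?_
  rw [completedBy_of_notMem π req N u hK h, numRemaining, Nat.sub_pos_iff_lt, not_le]

lemma numLate_le (K : ℝ) (s : SystemState) : numLate π req N u K s ≤ N := by
  classical
  rw [numLate]
  exact_mod_cast (Finset.card_filter_le _ _).trans_eq (Finset.card_range N)

open Classical in
lemma numLate_eq_sum (K : ℝ) (s : SystemState) : numLate π req N u K s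
    = ∑ i ∈ Finset.range N, if CompletedBy π req N u s K i then 0 else 1 := by
  simp [numLate, Finset.card_filter]

lemma measurable_numLate {X : Type*} [MeasurableSpace X] {u : X → unitInterval}
    (hu : Measurable u) {s : X → SystemState} (hs : StateMeasurable s)
    {K : X → ℝ} (hK : Measurable K) :
    Measurable fun x => numLate π req N (u x) (K x) (s x) := by
  classical
  simp only [numLate_eq_sum]
  exact Finset.measurable_fun_sum _ fun i _ => Measurable.ite
    (measurableSet_completedBy π req N hu hs hK i) measurable_const measurable_const

/-- A chunk that does not exist: it stands for the idle threads. -/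
def idleChunk : Chunk := (N, 0)

lemma idleChunk_notMem : idleChunk N ∉ allChunks req N := by
  simp [idleChunk, allChunks]

lemma ne_idleChunk {req N} {l : DownloadLog} {c : Chunk} (hc : c ∈ allChunks req N \ downloaded l) :
    c ≠ idleChunk N := by
  rintro rfl
  exact idleChunk_notMem req N (Finset.mem_sdiff.1 hc).1

/-- The chunks that may be the next to complete, including the idle one. -/
def clocks (l : DownloadLog) : Finset Chunk :=
  insert (idleChunk N) (allChunks req N \ downloaded l)

/-- The rate at which chunk `c` is served, where the idle threads serve the idle chunk. -/
noncomputable def fullRate (l : DownloadLog) (c : Chunk) (v : ℝ) : ℝ≥0∞ :=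
  if c = idleChunk N then ((L - (served π req N u l v).card : ℕ) : ℝ≥0∞)
  else serviceRate π req N u l c v

/-- The cumulated service from time `t₀` on, where the idle threads serve the idle chunk. -/
noncomputable def fullService (t₀ : ℝ) (l : DownloadLog) (c : Chunk) (t : ℝ) : ℝ :=
  if c = idleChunk N then (∫⁻ v in Set.Ioc t₀ t, fullRate π req N u l c v).toReal
  else serviceTime π req N u ⟨t₀, l, 0⟩ c t

variable {req N} (hmono : ∀ i j, i ≤ j → j < N → (req i).arrival ≤ (req j).arrival)
include hmono

lemma sum_serviceRate (l : DownloadLog) (v : ℝ) :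
    ∑ c ∈ allChunks req N \ downloaded l, serviceRate π req N u l c v
      = ((served π req N u l v).card : ℝ≥0∞) := by
  have : ∀ c, serviceRate π req N u l c v = if c ∈ served π req N u l v then 1 else 0 := by
    intro c
    simp [serviceRate, Set.indicator_apply]
  simp only [this, Finset.sum_boole]
  congr 2
  ext c
  rw [Finset.mem_filter, and_iff_right_iff_imp]
  exact fun hc => (mem_served hmono hc).2.2

/-- With the idle chunk included, the total rate is the same for all policies at all times; this is
what makes their event times comparable. -/
lemma sum_fullRate (l : DownloadLog) (v : ℝ) :
    ∑ c ∈ clocks req N l, fullRate π req N u l c v = L := by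
  rw [clocks, Finset.sum_insert (fun h => idleChunk_notMem req N (Finset.mem_sdiff.1 h).1)]
  rw [Finset.sum_congr rfl (g := fun c => serviceRate π req N u l c v) fun c hc => by
    rw [fullRate, if_neg (ne_idleChunk hc)]]
  rw [sum_serviceRate π u hmono, fullRate, if_pos rfl, ← Nat.cast_add,
    Nat.sub_add_cancel (show (served π req N u l v).card ≤ L from π.card_le _ _)]

omit hmono in
lemma measurable_serviceRate (l : DownloadLog) (c : Chunk) :
    Measurable (serviceRate π req N u l c) :=
  measurable_one.indicator (measurableSet_served π req N u l c)

lemma measurable_fullRate (l : DownloadLog) (c : Chunk) :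
    Measurable (fullRate π req N u l c) := by
  by_cases hc : c = idleChunk N
  · have : fullRate π req N u l c = fun v => (L : ℝ≥0∞) -
        ∑ c ∈ allChunks req N \ downloaded l, serviceRate π req N u l c v := by
      ext v
      rw [fullRate, if_pos hc, sum_serviceRate π u hmono, ENNReal.natCast_sub]
    rw [this]
    exact measurable_const.sub
      (Finset.measurable_fun_sum _ fun c _ => measurable_serviceRate π u l c)
  · have : fullRate π req N u l c = serviceRate π req N u l c := by
      ext v; rw [fullRate, if_neg hc]
    rw [this]
    exact measurable_serviceRate π u l c

lemma sum_fullService (t₀ : ℝ) (l : DownloadLog) {t : ℝ} (ht : t₀ ≤ t) :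
    ∑ c ∈ clocks req N l, fullService π req N u t₀ l c t = L * (t - t₀) := by
  have hfin : ∀ c ∈ clocks req N l, ∫⁻ v in Set.Ioc t₀ t, fullRate π req N u l c v ≠ ∞ := by
    intro c hc
    refine ne_top_of_le_ne_top (b := ∫⁻ v in Set.Ioc t₀ t, (L : ℝ≥0∞)) ?_
      (lintegral_mono fun v => ?_)
    · rw [setLIntegral_const]
      exact ENNReal.mul_ne_top (by simp) (by simp)
    · rw [← sum_fullRate π u hmono l v]
      exact Finset.single_le_sum (f := fun c => fullRate π req N u l c v)
        (fun _ _ => zero_le) hc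
  have heq : ∀ c ∈ clocks req N l, fullService π req N u t₀ l c t
      = (∫⁻ v in Set.Ioc t₀ t, fullRate π req N u l c v).toReal := by
    intro c hc
    by_cases hci : c = idleChunk N
    · rw [fullService, if_pos hci]
    · simp only [fullService, fullRate, if_neg hci]
      rw [(isCumulative_serviceTime π req N u ⟨t₀, l, 0⟩ c).lintegral t ht,
        ENNReal.toReal_ofReal (serviceTime_nonneg _ _ _ _ _ _ _)]
  rw [Finset.sum_congr rfl heq, ← ENNReal.toReal_sum hfin,
    ← lintegral_finsetSum _ fun c _ => measurable_fullRate π u hmono l c]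
  simp only [sum_fullRate π u hmono]
  rw [setLIntegral_const, Real.volume_Ioc, ENNReal.toReal_mul, ENNReal.toReal_natCast,
    ENNReal.toReal_ofReal (sub_nonneg.2 ht)]

lemma isCumulative_fullService (t₀ : ℝ) (l : DownloadLog) (c : Chunk) :
    IsCumulative t₀ (fullRate π req N u l c) (fullService π req N u t₀ l c) := by
  by_cases hci : c = idleChunk N
  · have hfin : ∀ t, ∫⁻ v in Set.Ioc t₀ t, fullRate π req N u l c v ≠ ∞ := by
      intro t
      refine ne_top_of_le_ne_top (b := ∫⁻ v in Set.Ioc t₀ t, (L : ℝ≥0∞)) ?_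
        (lintegral_mono fun v => ?_)
      · rw [setLIntegral_const]
        exact ENNReal.mul_ne_top (by simp) (by simp)
      · rw [fullRate, if_pos hci]
        exact Nat.cast_le.2 (Nat.sub_le _ _)
    have hval : ∀ t, fullService π req N u t₀ l c t
        = (∫⁻ v in Set.Ioc t₀ t, fullRate π req N u l c v).toReal := by
      intro t; rw [fullService, if_pos hci]
    have hzero : ∀ t ≤ t₀, fullService π req N u t₀ l c t = 0 := by
      intro t ht
      rw [hval, Set.Ioc_eq_empty (not_lt.2 ht)]
      simp
    -- Continuity of the idle service follows by complement: it is the total L (t - t₀) minus the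
    -- service of the real chunks. The maximum covers times before `t₀`.
    have hcont : fullService π req N u t₀ l c = fun t => L * (max t t₀ - t₀)
        - ∑ c ∈ allChunks req N \ downloaded l, serviceTime π req N u ⟨t₀, l, 0⟩ c t := by
      ext t
      rcases le_total t t₀ with h | h
      · rw [hzero t h, max_eq_right h, Finset.sum_eq_zero]
        · simp
        · exact fun c _ => serviceTime_of_le π req N u _ c h
      · have hs := sum_fullService π u hmono t₀ l h
        rw [clocks, Finset.sum_insert
          (fun h => idleChunk_notMem req N (Finset.mem_sdiff.1 h).1), ← hci] at hs
        rw [max_eq_left h, ← hs, eq_sub_iff_add_eq]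
        congr 1
        refine Finset.sum_congr rfl fun c hc => ?_
        rw [fullService, if_neg (ne_idleChunk hc)]
    refine ⟨?_, ?_, hzero t₀ le_rfl, measurable_fullRate π u hmono l c, ?_⟩
    · intro t t' h
      rw [hval, hval]
      exact ENNReal.toReal_mono (hfin t') (lintegral_mono_set (Set.Ioc_subset_Ioc_right h))
    · rw [hcont]
      refine Continuous.sub (by fun_prop) (continuous_finsetSum _ fun c _ => ?_)
      exact continuous_serviceTime π req N u _ c
    · intro t _
      rw [hval, ENNReal.ofReal_toReal (hfin t)]
  · have h1 : fullRate π req N u l c = serviceRate π req N u l c := by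
      ext v; rw [fullRate, if_neg hci]
    have h2 : fullService π req N u t₀ l c = serviceTime π req N u ⟨t₀, l, 0⟩ c := by
      ext t; rw [fullService, if_neg hci]
    rw [h1, h2]
    exact isCumulative_serviceTime π req N u ⟨t₀, l, 0⟩ c

variable (N) in
omit hmono in
/-- The log after clock `j` has expired at time `t`. -/
def logAfter (l : DownloadLog) (j : Chunk) (t : ℝ) : DownloadLog :=
  if j = idleChunk N then l else l ++ [(t, {j})]

/-- The expected number of late requests when the downloading times of the missing chunks are
fresh. -/
noncomputable def expectedLate {L : ℕ} (π : OnlinePolicy L) (req : ℕ → Request) (N : ℕ)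
    (u : unitInterval) (μ K t : ℝ) (l : DownloadLog) : ℝ≥0∞ :=
  ∫⁻ x, numLate π req N u K ⟨t, l, x⟩ ∂(Measure.infinitePi (fun _ : Chunk => expMeasure μ))

/-- Pathwise form of the recursion, with τ the first expiry. If K < τ, no download completes by K
and the count is read off the log. If the idle clock expires, the run restarts at τ with the same
log. If a real chunk expires, the run passes to its next state. In the last two cases only residuals
matter for the future. -/
lemma numLate_of_firstEvent {t₀ K : ℝ} (hK : t₀ ≤ K) (l : DownloadLog) {j : Chunk}
    (hj : j ∈ clocks req N l) {x : Chunk → ℝ}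
    (hx : x ∈ firstEvent t₀ (fullService π req N u t₀ l) (clocks req N l) j) :
    numLate π req N u K ⟨t₀, l, x⟩
      = (fun t y => if K < t then (numIncomplete req N l : ℝ≥0∞)
          else numLate π req N u K ⟨t, logAfter N l j t, y⟩)
        (firstPassage t₀ (fullService π req N u t₀ l j) (x j))
        (fun c => x c - fullService π req N u t₀ l c
          (firstPassage t₀ (fullService π req N u t₀ l j) (x j))) := by
  set τ := firstPassage t₀ (fullService π req N u t₀ l j) (x j) with hτ
  obtain ⟨hxj, hfirst⟩ := hx
  have hcum := isCumulative_fullService π u hmono t₀ l j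
  have hlt : t₀ < τ := hcum.lt_firstPassage hxj
  have hserv : ∀ c ∈ allChunks req N \ downloaded l, ∀ t,
      fullService π req N u t₀ l c t = serviceTime π req N u ⟨t₀, l, x⟩ c t := by
    intro c hc t
    rw [fullService, if_neg (ne_idleChunk hc)]
    rfl
  have hbefore : ∀ t < τ, t ∉ completionInstants π req N u ⟨t₀, l, x⟩ := by
    rintro t ht ⟨-, c, hc, hle⟩
    rw [← hserv c hc] at hle
    have hle : x c ≤ fullService π req N u t₀ l c t := hle
    by_cases hcj : c = j
    · subst hcj
      exact absurd ((hcum.firstPassage_le_iff hxj t).2 hle) (not_le.2 ht)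
    · have h1 := hfirst c (Finset.mem_erase.2 ⟨hcj, Finset.mem_insert_of_mem hc⟩)
      have h2 := (isCumulative_fullService π u hmono t₀ l c).monotone
        ht.le
      exact absurd (hle.trans h2) (not_le.2 h1)
  by_cases hKτ : K < τ
  · simp only [if_pos hKτ]
    rw [numLate_of_notMem π req N u (s := ⟨t₀, l, x⟩) hK (hbefore K hKτ)]
  simp only [if_neg hKτ]
  by_cases hji : j = idleChunk N
  · have hnot : τ ∉ completionInstants π req N u ⟨t₀, l, x⟩ := by
      rintro ⟨-, c, hc, hle⟩
      rw [← hserv c hc] at hle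
      have h1 := hfirst c (Finset.mem_erase.2
        ⟨hji ▸ ne_idleChunk hc, Finset.mem_insert_of_mem hc⟩)
      exact absurd hle (not_le.2 h1)
    refine (numLate_congr π req N u
      (completedBy_restart π req N u (s := ⟨t₀, l, x⟩) hlt.le (not_lt.1 hKτ) hnot)).trans ?_
    refine numLate_congr π req N u fun i => SameFuture.completedBy π req N u ?_ K i
    refine ⟨rfl, by rw [logAfter, if_pos hji], fun c hc => ?_⟩
    simp only
    rw [hserv c hc]
  · have hjm : j ∈ allChunks req N \ downloaded l := (Finset.mem_insert.1 hj).resolve_left hji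
    have hmem : τ ∈ completionInstants π req N u ⟨t₀, l, x⟩ := by
      refine ⟨hlt.le, j, hjm, ?_⟩
      rw [← hserv j hjm, hcum.apply_firstPassage hxj]
    have hne : (completionInstants π req N u ⟨t₀, l, x⟩).Nonempty := ⟨τ, hmem⟩
    have hinf : sInf (completionInstants π req N u ⟨t₀, l, x⟩) = τ := by
      refine le_antisymm (csInf_le (bddBelow_completionInstants π req N u _) hmem) ?_
      refine le_csInf hne fun t ht => ?_
      by_contra h
      exact hbefore t (not_le.1 h) ht
    have htime : (nextState π req N u ⟨t₀, l, x⟩).time = τ := by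
      rw [nextState, if_pos hne, hinf]
    refine (numLate_congr π req N u
      (completedBy_nextState π req N u (htime.trans_le (not_lt.1 hKτ)))).trans ?_
    refine numLate_congr π req N u fun i => SameFuture.completedBy π req N u ?_ K i
    have hlog : (nextState π req N u ⟨t₀, l, x⟩).log = l ++ [(τ, {j})] := by
      rw [nextState, if_pos hne, hinf]
      simp only
      congr 3
      ext c
      rw [Finset.mem_filter, Finset.mem_singleton]
      constructor
      · rintro ⟨hc, hle⟩
        by_contra hcj
        have h1 := hfirst c (Finset.mem_erase.2 ⟨hcj, Finset.mem_insert_of_mem hc⟩)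
        rw [← hserv c hc] at hle
        exact absurd hle (not_le.2 h1)
      · rintro rfl
        refine ⟨hjm, ?_⟩
        rw [← hserv c hjm, hcum.apply_firstPassage hxj]
    refine ⟨htime, by rw [hlog, logAfter, if_neg hji], fun c hc => ?_⟩
    rw [hlog, downloaded_append] at hc
    have hc' : c ∈ allChunks req N \ downloaded l := by
      simp only [Finset.mem_sdiff, Finset.mem_union] at hc ⊢
      tauto
    rw [nextState, if_pos hne, hinf]
    simp only
    rw [hserv c hc']

/-- Conditioning on the first completion, where the idle threads complete idle chunks. -/
lemma expectedLate_eq {μ : ℝ} (hμ : 0 < μ) (hL : 0 < L) {t₀ K : ℝ} (hK : t₀ ≤ K)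
    (l : DownloadLog) :
    expectedLate π req N u μ K t₀ l
      = ∫⁻ t in Set.Ioi t₀, ENNReal.ofReal (Real.exp (-(μ * L * (t - t₀)))) *
          ∑ j ∈ clocks req N l, (ENNReal.ofReal μ * fullRate π req N u l j t *
            if K < t then (numIncomplete req N l : ℝ≥0∞)
            else expectedLate π req N u μ K t (logAfter N l j t)) := by
  have := isProbabilityMeasure_expMeasure hμ
  rw [expectedLate, lintegral_eq_of_firstEvent (L := (L : ℝ)) (t₀ := t₀)
    (S := clocks req N l) (a := fullRate π req N u l) (A := fullService π req N u t₀ l)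
    hμ (by exact_mod_cast hL)
    (fun j _ => isCumulative_fullService π u hmono t₀ l j)
    (fun t ht => sum_fullService π u hmono t₀ l ht)
    (fun t _ => by rw [sum_fullRate π u hmono, ENNReal.ofReal_natCast])
    (fun j t y => if K < t then (numIncomplete req N l : ℝ≥0∞)
          else numLate π req N u K ⟨t, logAfter N l j t, y⟩) ?_ ?_ _
    (fun j hj x hx => numLate_of_firstEvent π u hmono hK l hj hx)]
  · refine lintegral_congr fun t => ?_
    congr 1
    refine Finset.sum_congr rfl fun j _ => ?_
    congr 1
    by_cases h : K < t
    · simp [h]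
    · simp [h, expectedLate]
  · intro j _
    refine Measurable.ite (measurableSet_lt measurable_const measurable_fst) measurable_const ?_
    refine measurable_numLate π req N measurable_const ⟨measurable_fst, ?_, measurable_snd⟩
      measurable_const
    simp only [logAfter]
    split_ifs
    · exact logMeasurable_const l
    · exact (logMeasurable_const l).append measurable_fst fun B => MeasurableSet.const _
  · intro j _ t y y' hy
    split_ifs
    · rfl
    · refine numLate_congr π req N u fun i => SameFuture.completedBy π req N u ?_ K i
      refine ⟨rfl, rfl, fun c hc => hy c ?_⟩
      -- The coordinate `j` is never consulted afterwards: either it belongs to the idle chunk, or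
      -- chunk `j` is now in the log.
      simp only [logAfter] at hc
      split_ifs at hc with hji
      · exact Finset.mem_erase.2 ⟨hji ▸ ne_idleChunk hc, Finset.mem_insert_of_mem hc⟩
      · rw [downloaded_append] at hc
        simp only [Finset.mem_sdiff, Finset.mem_union, Finset.mem_singleton, not_or] at hc
        exact Finset.mem_erase.2 ⟨hc.2.2, Finset.mem_insert_of_mem
          (Finset.mem_sdiff.2 ⟨hc.1, hc.2.1⟩)⟩

end Step

/-! ### Comparison of SERPT-R with an arbitrary policy -/

section Comparison

/-- Both sums have total weight `W`, so each `X j` may be compared with the smallest `Y j'` of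
nonzero weight. No coupling of the two choices is needed, because the bound holds for all pairs. -/
lemma weighted_sum_le {ι : Type*} {S S' : Finset ι} {w X w' Y : ι → ℝ≥0∞} {W e : ℝ≥0∞}
    (hw : ∑ j ∈ S, w j = W) (hw' : ∑ j ∈ S', w' j = W)
    (h : ∀ j ∈ S, w j ≠ 0 → ∀ j' ∈ S', w' j' ≠ 0 → X j ≤ Y j' + e) :
    ∑ j ∈ S, w j * X j ≤ ∑ j ∈ S', w' j * Y j + W * e := by
  classical
  rcases eq_or_ne W 0 with rfl | hW
  · rw [Finset.sum_eq_zero_iff] at hw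
    rw [Finset.sum_eq_zero fun j hj => by rw [hw j hj, zero_mul]]
    exact zero_le
  have hne : (S'.filter fun j => w' j ≠ 0).Nonempty := by
    by_contra hemp
    rw [Finset.not_nonempty_iff_eq_empty, Finset.filter_eq_empty_iff] at hemp
    exact hW (hw'.symm.trans (Finset.sum_eq_zero fun j hj => not_not.1 (hemp hj)))
  obtain ⟨m, hm, hmin⟩ := Finset.exists_min_image _ Y hne
  rw [Finset.mem_filter] at hm
  calc ∑ j ∈ S, w j * X j ≤ ∑ j ∈ S, w j * (Y m + e) := by
        refine Finset.sum_le_sum fun j hj => ?_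
        rcases eq_or_ne (w j) 0 with h0 | h0
        · simp [h0]
        · exact mul_le_mul_right (h j hj h0 m hm.1 hm.2) _
    _ = ∑ j ∈ S', w' j * Y m + W * e := by
        rw [← Finset.sum_mul, ← Finset.sum_mul, hw, hw', mul_add]
    _ ≤ _ := by
        refine add_le_add_left (Finset.sum_le_sum fun j hj => ?_) _
        rcases eq_or_ne (w' j) 0 with h0 | h0
        · simp [h0]
        · exact mul_le_mul_right (hmin j (Finset.mem_filter.2 ⟨hj, h0⟩)) _

variable {L : ℕ} {req : ℕ → Request} {N : ℕ}

/-- The requests of log `l` are at least as far advanced, at time `t`, as those of log `l'`. -/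
def Ahead (req : ℕ → Request) (N : ℕ) (t : ℝ) (l l' : DownloadLog) : Prop :=
  (∀ i < N, i ∉ arrivedSet req N t → numRemaining req l i = numRemaining req l' i) ∧
    Dominated (arrivedSet req N t) (numRemaining req l) (numRemaining req l')

lemma Ahead.mono {t t' : ℝ} {l l' : DownloadLog} (h : Ahead req N t l l') (ht : t ≤ t') :
    Ahead req N t' l l' :=
  ⟨fun i hi hi' => h.1 i hi fun hm => hi' (arrivedSet_mono ht hm),
    h.2.extend (arrivedSet_mono ht) fun i hi hi' => h.1 i (mem_arrivedSet.1 hi).1 hi'⟩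

lemma Ahead.numIncomplete_le {t : ℝ} {l l' : DownloadLog} (h : Ahead req N t l l') :
    numIncomplete req N l ≤ numIncomplete req N l' :=
  (h.2.extend (J := Finset.range N) (Finset.filter_subset _ _)
    fun i hi hi' => h.1 i (Finset.mem_range.1 hi) hi').card_pos_le

variable (hmono : ∀ i j, i ≤ j → j < N → (req i).arrival ≤ (req j).arrival)
  (hk : ∀ i < N, (req i).k ≤ (req i).n) (hd : ∀ i < N, L ≤ (req i).dist)

include hmono in
/-- What happens when clock `j`, which runs at time `t`, expires. -/
lemma numRemaining_logAfter {π : OnlinePolicy L} {u : unitInterval} {l : DownloadLog} {t : ℝ}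
    {j : Chunk} (hj : fullRate π req N u l j t ≠ 0) :
    (j = idleChunk N ∧ logAfter N l j t = l ∧ (served π req N u l t).card < L) ∨
    (j ∈ served π req N u l t ∧ j.1 ∈ arrivedSet req N t ∧ 0 < numRemaining req l j.1 ∧
      numRemaining req (logAfter N l j t)
        = Function.update (numRemaining req l) j.1 (numRemaining req l j.1 - 1)) := by
  by_cases hji : j = idleChunk N
  · left
    refine ⟨hji, by rw [logAfter, if_pos hji], ?_⟩
    rw [fullRate, if_pos hji] at hj
    by_contra h
    exact hj (by rw [Nat.sub_eq_zero_of_le (not_lt.1 h), Nat.cast_zero])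
  · right
    rw [fullRate, if_neg hji, serviceRate] at hj
    have hs : t ∈ {v : ℝ | j ∈ served π req N u l v} := Set.mem_of_indicator_ne_zero hj
    have hm := mem_served hmono hs
    refine ⟨hs, hm.1, hm.2.1, ?_⟩
    rw [logAfter, if_neg hji, numRemaining_append (Finset.mem_sdiff.1 hm.2.2).2]

include hmono hk hd in
-- If SERPT-R idles, all arrived requests are complete in its run and domination is trivial.
-- Otherwise it lowers a smallest positive entry: against an idle opponent only the left vector
-- decreases, and against a serving one `Dominated.decrease_both` applies.
lemma Ahead.logAfter {σ π : OnlinePolicy L} (hσ : σ.IsSERPTR) {u u' : unitInterval}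
    {l l' : DownloadLog} {t : ℝ} (h : Ahead req N t l l') {j j' : Chunk}
    (hj : fullRate σ req N u l j t ≠ 0) (hj' : fullRate π req N u' l' j' t ≠ 0) :
    Ahead req N t (logAfter N l j t) (logAfter N l' j' t) := by
  have hupd : ∀ {r : ℕ → ℕ} {c i : ℕ} {b : ℕ}, c ∈ arrivedSet req N t → i ∉ arrivedSet req N t →
      Function.update r c b i = r i := by
    intro r c i b hc hi
    rw [Function.update_of_ne]
    rintro rfl
    exact hi hc
  rcases numRemaining_logAfter hmono hj with ⟨-, h1, h2⟩ | ⟨h1, h2, h3, h4⟩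
  · have hzero : ∀ i ∈ arrivedSet req N t, numRemaining req l i = 0 :=
      fun i hi => numRemaining_eq_zero_of_idle hmono hk hd hσ h2 hi
    rw [h1]
    refine ⟨fun i hi hi' => ?_, Dominated.of_zero _ hzero⟩
    rcases numRemaining_logAfter hmono hj' with ⟨-, h1', -⟩ | ⟨-, h2', -, h4'⟩
    · rw [h1']; exact h.1 i hi hi'
    · rw [h4', hupd h2' hi']; exact h.1 i hi hi'
  · have hmin : ∀ i ∈ arrivedSet req N t, 0 < numRemaining req l i →
        numRemaining req l j.1 ≤ numRemaining req l i :=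
      fun i hi hpos => numRemaining_le_of_mem_served hmono hk hd hσ h1 hi hpos
    rw [Ahead, h4]
    rcases numRemaining_logAfter hmono hj' with ⟨-, h1', -⟩ | ⟨-, h2', h3', h4'⟩
    · rw [h1']
      refine ⟨fun i hi hi' => (hupd h2 hi').trans (h.1 i hi hi'), h.2.decrease_left fun i => ?_⟩
      by_cases hi : i = j.1
      · rw [hi, Function.update_self]; exact Nat.sub_le _ _
      · rw [Function.update_of_ne hi]
    · rw [h4']
      refine ⟨fun i hi hi' => ?_, h.2.decrease_both h2 h3 hmin h2' h3'⟩
      rw [hupd h2 hi', hupd h2' hi']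
      exact h.1 i hi hi'

lemma expectedLate_le_card {μ : ℝ} (hμ : 0 < μ) (π : OnlinePolicy L) (u : unitInterval)
    (K t : ℝ) (l : DownloadLog) : expectedLate π req N u μ K t l ≤ N := by
  have := isProbabilityMeasure_expMeasure hμ
  refine (lintegral_mono fun x => numLate_le π req N u K ⟨t, l, x⟩).trans ?_
  rw [lintegral_const, measure_univ, mul_one]

include hmono hk hd in
-- Idle events leave the log unchanged, so the number of events has no bound and the recursion must
-- be truncated. After n events the trivial bound N is used. The error is a Chernoff bound: ρ = μL /
-- (μL + 1) is the mean of exp(-T) for T exponential of rate μL, so n events occur by time K with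
-- probability at most ρ ^ n * exp (K - t).
lemma expectedLate_le_add {μ : ℝ} (hμ : 0 < μ) (hL : 0 < L) {σ : OnlinePolicy L}
    (hσ : σ.IsSERPTR) (π : OnlinePolicy L) (u u' : unitInterval) {K : ℝ} (n : ℕ) :
    ∀ t l l', t ≤ K → Ahead req N t l l' →
      expectedLate σ req N u μ K t l ≤ expectedLate π req N u' μ K t l' +
        N * ENNReal.ofReal (μ * L / (μ * L + 1)) ^ n * ENNReal.ofReal (Real.exp (K - t)) := by
  induction n with
  | zero =>
    intro t l l' ht _
    refine (expectedLate_le_card hμ σ u K t l).trans (le_add_left ?_)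
    rw [pow_zero, mul_one]
    refine le_mul_of_one_le_right zero_le (ENNReal.one_le_ofReal.2 (Real.one_le_exp ?_))
    linarith
  | succ n ih =>
    intro t₀ l l' ht₀ hahead
    have hLr : (0 : ℝ) < L := by exact_mod_cast hL
    have hr : 0 < μ * L := by positivity
    set ρ := ENNReal.ofReal (μ * L / (μ * L + 1)) with hρ
    rw [expectedLate_eq σ u hmono hμ hL ht₀, expectedLate_eq π u' hmono hμ hL ht₀]
    -- The error term reproduces itself: averaging exp(K - t) over the time of the next event yields
    -- one more factor ρ.
    have herr : ∫⁻ t in Set.Ioi t₀, ENNReal.ofReal (Real.exp (-(μ * L * (t - t₀)))) *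
          (ENNReal.ofReal (μ * L) * (N * ρ ^ n * ENNReal.ofReal (Real.exp (K - t))))
        = N * ρ ^ (n + 1) * ENNReal.ofReal (Real.exp (K - t₀)) := by
      have h1 : ∀ t, ENNReal.ofReal (Real.exp (-(μ * L * (t - t₀)))) *
          (ENNReal.ofReal (μ * L) * (N * ρ ^ n * ENNReal.ofReal (Real.exp (K - t))))
          = (N * ρ ^ n * ENNReal.ofReal (μ * L) * ENNReal.ofReal (Real.exp (K - t₀))) *
            ENNReal.ofReal (Real.exp (-((μ * L + 1) * (t - t₀)))) := by
        intro t
        have h2 : ENNReal.ofReal (Real.exp (-(μ * L * (t - t₀)))) *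
            ENNReal.ofReal (Real.exp (K - t)) = ENNReal.ofReal (Real.exp (K - t₀)) *
            ENNReal.ofReal (Real.exp (-((μ * L + 1) * (t - t₀)))) := by
          rw [← ENNReal.ofReal_mul (Real.exp_pos _).le, ← ENNReal.ofReal_mul (Real.exp_pos _).le,
            ← Real.exp_add, ← Real.exp_add]
          ring_nf
        calc _ = N * ρ ^ n * ENNReal.ofReal (μ * L) *
              (ENNReal.ofReal (Real.exp (-(μ * L * (t - t₀)))) *
                ENNReal.ofReal (Real.exp (K - t))) := by ring
          _ = _ := by rw [h2]; ring
      have hρm : ρ = ENNReal.ofReal (μ * L) * ENNReal.ofReal (μ * L + 1)⁻¹ := by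
        rw [hρ, div_eq_mul_inv, ENNReal.ofReal_mul hr.le]
      simp only [h1]
      rw [lintegral_const_mul _ (by fun_prop), setLIntegral_exp_Ioi (by positivity), pow_succ]
      nth_rw 3 [hρm]
      ring
    rw [← herr, ← lintegral_add_right _ (by fun_prop)]
    refine setLIntegral_mono' measurableSet_Ioi fun t ht => ?_
    rw [← mul_add]
    refine mul_le_mul_right ?_ _
    have ht' : t₀ ≤ t := le_of_lt ht
    have hsum : ∀ (π : OnlinePolicy L) (u : unitInterval) (l : DownloadLog),
        ∑ j ∈ clocks req N l, ENNReal.ofReal μ * fullRate π req N u l j t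
          = ENNReal.ofReal (μ * L) := by
      intro π u l
      rw [← Finset.mul_sum, sum_fullRate π u hmono, ENNReal.ofReal_mul hμ.le,
        ENNReal.ofReal_natCast]
    refine weighted_sum_le (hsum σ u l) (hsum π u' l') fun j _ hj j' _ hj' => ?_
    -- If the next event comes after K, both counts are frozen at their current values, which the
    -- invariant compares. Otherwise the invariant passes to the new logs.
    by_cases hKt : K < t
    · rw [if_pos hKt, if_pos hKt]
      exact le_add_right (Nat.cast_le.2 hahead.numIncomplete_le)
    · rw [if_neg hKt, if_neg hKt]
      exact ih t _ _ (not_lt.1 hKt) ((hahead.mono ht').logAfter hmono hk hd hσ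
        (right_ne_zero_of_mul hj) (right_ne_zero_of_mul hj'))

include hmono hk hd in
/-- At any time, the expected number of late requests is smallest under SERPT-R. -/
theorem expectedLate_le {μ : ℝ} (hμ : 0 < μ) (hL : 0 < L) {σ : OnlinePolicy L}
    (hσ : σ.IsSERPTR) (π : OnlinePolicy L) (u u' : unitInterval) {K t : ℝ} {l l' : DownloadLog}
    (ht : t ≤ K) (h : Ahead req N t l l') :
    expectedLate σ req N u μ K t l ≤ expectedLate π req N u' μ K t l' := by
  have hLr : (0 : ℝ) < L := by exact_mod_cast hL
  have hρ : ENNReal.ofReal (μ * L / (μ * L + 1)) < 1 := by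
    rw [ENNReal.ofReal_lt_one, div_lt_one (by positivity)]
    linarith
  have hlim : Tendsto (fun n : ℕ => expectedLate π req N u' μ K t l' +
      N * ENNReal.ofReal (μ * L / (μ * L + 1)) ^ n * ENNReal.ofReal (Real.exp (K - t))) atTop
      (nhds (expectedLate π req N u' μ K t l' + N * 0 * ENNReal.ofReal (Real.exp (K - t)))) := by
    refine tendsto_const_nhds.add (ENNReal.Tendsto.mul_const (ENNReal.Tendsto.const_mul
      (ENNReal.tendsto_pow_atTop_nhds_zero_of_lt_one hρ) (Or.inr (ENNReal.natCast_ne_top N)))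
      (Or.inr ENNReal.ofReal_ne_top))
  rw [mul_zero, zero_mul, add_zero] at hlim
  exact ge_of_tendsto' hlim fun n =>
    expectedLate_le_add hmono hk hd hμ hL hσ π u u' n t l l' ht h

end Comparison

/-! ### From late requests to the average flow time -/

section FlowTime

variable {L : ℕ} (π : OnlinePolicy L) (req : ℕ → Request) (N : ℕ) (u : unitInterval)

lemma completionTime_le_iff (x : Chunk → ℝ) (i : ℕ) {K : ℝ} (hK : 0 ≤ K) :
    completionTime π req N u x i ≤ ENNReal.ofReal K
      ↔ CompletedBy π req N u ⟨0, [], x⟩ K i := by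
  classical
  constructor
  · intro h
    -- The times of successive states do not decrease, so the infimum is attained at the first index
    -- with enough downloads.
    by_cases hex : ∃ m, (req i).k ≤ numDownloaded (stateAfter π req N u x m).log i
    · refine ⟨Nat.find hex, Nat.find_spec hex, ?_⟩
      rw [← ENNReal.ofReal_le_ofReal_iff hK]
      refine le_trans (le_iInf₂ fun m hm => ENNReal.ofReal_le_ofReal ?_) h
      obtain ⟨p, hp⟩ := Nat.exists_eq_add_of_le (Nat.find_min' hex hm)
      rw [stateAfter, hp, add_comm, Function.iterate_add_apply]
      exact le_time_iterate π req N u _ p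
    · push Not at hex
      exfalso
      have : completionTime π req N u x i = ∞ := by
        simp only [completionTime, iInf_eq_top]
        exact fun m hm => absurd hm (not_le.2 (hex m))
      rw [this, top_le_iff] at h
      exact ENNReal.ofReal_ne_top h
  · rintro ⟨m, h1, h2⟩
    exact (iInf₂_le m h1).trans (ENNReal.ofReal_le_ofReal h2)

lemma volume_ofReal_lt (c : ℝ≥0∞) :
    volume (Set.Ioi 0 ∩ {K : ℝ | ENNReal.ofReal K < c}) = c := by
  rcases eq_or_ne c ∞ with rfl | hc
  · simp
  · have : Set.Ioi 0 ∩ {K : ℝ | ENNReal.ofReal K < c} = Set.Ioo 0 c.toReal := by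
      ext K
      simp only [Set.mem_inter_iff, Set.mem_Ioi, Set.mem_ofPred_eq, Set.mem_Ioo]
      refine and_congr_right fun hK => ?_
      rw [ENNReal.ofReal_lt_iff_lt_toReal hK.le hc]
    rw [this, Real.volume_Ioo, sub_zero, ENNReal.ofReal_toReal hc]

-- Layer-cake formula: a completion time is the measure of the set of K > 0 at which the request is
-- still incomplete.
open Classical in
lemma completionTime_eq_lintegral (x : Chunk → ℝ) (i : ℕ) : completionTime π req N u x i
    = ∫⁻ K in Set.Ioi 0, if CompletedBy π req N u ⟨0, [], x⟩ K i then 0 else 1 := by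
  have hm : MeasurableSet {K : ℝ | ENNReal.ofReal K < completionTime π req N u x i} :=
    measurableSet_lt ENNReal.measurable_ofReal measurable_const
  conv_lhs => rw [← volume_ofReal_lt (completionTime π req N u x i), Set.inter_comm,
    ← Measure.restrict_apply hm, ← lintegral_indicator_one hm]
  refine setLIntegral_congr_fun measurableSet_Ioi fun K hK => ?_
  have hiff := completionTime_le_iff π req N u x i (le_of_lt hK)
  by_cases h : CompletedBy π req N u ⟨0, [], x⟩ K i
  · rw [if_pos h, Set.indicator_of_notMem]
    exact not_lt.2 (hiff.2 h)
  · rw [if_neg h, Set.indicator_of_mem, Pi.one_apply]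
    exact not_le.1 fun h' => h (hiff.1 h')

lemma stateMeasurable_start {X : Type*} [MeasurableSpace X] {x : X → Chunk → ℝ}
    (hx : Measurable x) : StateMeasurable fun p => (⟨0, [], x p⟩ : SystemState) :=
  ⟨measurable_const, logMeasurable_const [], hx⟩

lemma sum_completionTime (x : Chunk → ℝ) :
    ∑ i ∈ Finset.range N, completionTime π req N u x i
      = ∫⁻ K in Set.Ioi 0, numLate π req N u K ⟨0, [], x⟩ := by
  classical
  simp only [completionTime_eq_lintegral, numLate_eq_sum]
  rw [lintegral_finsetSum]
  exact fun i _ => Measurable.ite (measurableSet_completedBy π req N measurable_const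
    (stateMeasurable_start measurable_const) measurable_id i)
    measurable_const measurable_const

lemma measurable_completionTime (i : ℕ) : Measurable fun ω : unitInterval × (Chunk → ℝ) =>
    completionTime π req N ω.1 ω.2 i := by
  refine measurable_of_Iic fun c => ?_
  rcases eq_or_ne c ∞ with rfl | hc
  · simp
  · have : (fun ω : unitInterval × (Chunk → ℝ) => completionTime π req N ω.1 ω.2 i) ⁻¹' Set.Iic c
        = {ω | CompletedBy π req N ω.1 ⟨0, [], ω.2⟩ c.toReal i} := by
      ext ω
      have hiff := completionTime_le_iff π req N ω.1 ω.2 i (K := c.toReal) ENNReal.toReal_nonneg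
      rw [ENNReal.ofReal_toReal hc] at hiff
      exact hiff
    rw [this]
    exact measurableSet_completedBy π req N measurable_fst
      (stateMeasurable_start measurable_snd) measurable_const i

lemma measurable_numLate_start : Measurable (Function.uncurry
    fun (ω : unitInterval × (Chunk → ℝ)) (K : ℝ) => numLate π req N ω.1 K ⟨0, [], ω.2⟩) := by
  have hu : Measurable fun p : (unitInterval × (Chunk → ℝ)) × ℝ => p.1.1 :=
    measurable_fst.comp measurable_fst
  have hx : Measurable fun p : (unitInterval × (Chunk → ℝ)) × ℝ => p.1.2 :=
    measurable_snd.comp measurable_fst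
  exact measurable_numLate π req N hu (stateMeasurable_start hx)
    (K := fun p : (unitInterval × (Chunk → ℝ)) × ℝ => p.2) measurable_snd

lemma lintegral_numLate_start {μ : ℝ} (hμ : 0 < μ) (K : ℝ) :
    ∫⁻ ω, numLate π req N ω.1 K ⟨0, [], ω.2⟩ ∂(randomness μ)
      = ∫⁻ u, expectedLate π req N u μ K 0 [] := by
  have := isProbabilityMeasure_expMeasure hμ
  have hK : Measurable fun ω : unitInterval × (Chunk → ℝ) =>
      numLate π req N ω.1 K ⟨0, [], ω.2⟩ :=
    measurable_numLate π req N measurable_fst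
      (stateMeasurable_start measurable_snd) measurable_const
  rw [randomness, lintegral_prod _ hK.aemeasurable]
  simp only [expectedLate]

/-- Tonelli's theorem puts the integrals over K and the seed outside, so a comparison for each fixed
K and seed suffices. -/
lemma lintegral_sum_completionTime {μ : ℝ} (hμ : 0 < μ) :
    ∑ i ∈ Finset.range N, ∫⁻ ω, completionTime π req N ω.1 ω.2 i ∂(randomness μ)
      = ∫⁻ K in Set.Ioi 0, ∫⁻ u, expectedLate π req N u μ K 0 [] := by
  have := isProbabilityMeasure_expMeasure hμ
  have hfin : SFinite (randomness μ) := by rw [randomness]; infer_instance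
  rw [← lintegral_finsetSum _ fun i _ => measurable_completionTime π req N i]
  simp only [sum_completionTime]
  rw [lintegral_lintegral_swap (measurable_numLate_start π req N).aemeasurable]
  exact lintegral_congr fun K => lintegral_numLate_start π req N hμ K

/-- The arrival times are real, so no indeterminate form arises even if some expectation is
infinite; the arrival sum splits off and is common to both policies. -/
lemma sum_coe_sub (E : ℕ → ℝ≥0∞) (a : ℕ → ℝ) (S : Finset ℕ) :
    ∑ i ∈ S, ((E i : EReal) - (a i : EReal))
      = ((∑ i ∈ S, E i : ℝ≥0∞) : EReal) - ((∑ i ∈ S, a i : ℝ) : EReal) := by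
  induction S using Finset.induction_on with
  | empty => simp
  | insert i S hi ih =>
    rw [Finset.sum_insert hi, Finset.sum_insert hi, Finset.sum_insert hi, ih,
      EReal.coe_ennreal_add, sub_eq_add_neg, sub_eq_add_neg, sub_eq_add_neg, ← EReal.coe_neg,
      ← EReal.coe_neg, ← EReal.coe_neg, neg_add, EReal.coe_add, add_add_add_comm]

theorem averageFlowTimeFin_le {μ : ℝ} (hμ : 0 < μ) (hL : 0 < L)
    (hmono : ∀ i j, i ≤ j → j < N → (req i).arrival ≤ (req j).arrival)
    (hk : ∀ i < N, (req i).k ≤ (req i).n) (hd : ∀ i < N, L ≤ (req i).dist)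
    {σ : OnlinePolicy L} (hσ : σ.IsSERPTR) :
    averageFlowTimeFin σ μ req N ≤ averageFlowTimeFin π μ req N := by
  rw [averageFlowTimeFin, averageFlowTimeFin, sum_coe_sub, sum_coe_sub]
  refine mul_le_mul_of_nonneg_left (EReal.sub_le_sub ?_ le_rfl) ?_
  · rw [EReal.coe_ennreal_le_coe_ennreal_iff, lintegral_sum_completionTime _ _ _ hμ,
      lintegral_sum_completionTime _ _ _ hμ]
    refine setLIntegral_mono' measurableSet_Ioi fun K hK => lintegral_mono fun u => ?_
    exact expectedLate_le hmono hk hd hμ hL hσ π u u (le_of_lt hK)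
      ⟨fun _ _ _ => rfl, Dominated.refl _ _⟩
  · exact EReal.coe_nonneg.2 (by positivity)

theorem averageFlowTime_le {μ : ℝ} (hμ : 0 < μ) (hL : 0 < L) {N : ℕ∞}
    (hreq : IsRequestSequence req N) (hd : (L : ℕ∞) ≤ minDist req N)
    {σ : OnlinePolicy L} (hσ : σ.IsSERPTR) :
    averageFlowTime σ μ req N ≤ averageFlowTime π μ req N := by
  have key : ∀ n : ℕ, (n : ℕ∞) ≤ N → averageFlowTimeFin σ μ req n ≤ averageFlowTimeFin π μ req n := by
    intro n hn
    have hlt : ∀ i, i < n → (i : ℕ∞) < N := fun i hi => (Nat.cast_lt.2 hi).trans_le hn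
    refine averageFlowTimeFin_le π req n hμ hL
      (fun i j hij hj => hreq.arrival_mono i j hij (hlt j hj))
      (fun i hi => hreq.k_le_n i (hlt i hi)) (fun i hi => ?_) hσ
    have := hd.trans (iInf₂_le i (hlt i hi))
    exact_mod_cast this
  rw [averageFlowTime, averageFlowTime]
  split_ifs with h
  · exact limsup_le_limsup (Eventually.of_forall fun n => key n (h ▸ le_top))
  · exact key _ (ENat.natCast_toNat_le_self N)

end FlowTime

/-! ### Existence of a SERPT-R policy -/

section Existence

lemma Observation.fst_of_mem_available {o : Observation} {i : ℕ} {c : Chunk}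
    (hc : c ∈ o.available i) : c.1 = i := by
  rw [Observation.available] at hc
  split at hc
  · simp only [Finset.mem_sdiff, Finset.mem_product, Finset.mem_singleton] at hc
    exact hc.1.1
  · simp at hc

open Classical in
/-- The available chunks of the unfinished requests. -/
noncomputable def Observation.candidates (o : Observation) : Finset Chunk :=
  ((Finset.range o.arrived.length).filter o.Unfinished).biUnion o.available

lemma Observation.mem_candidates {o : Observation} {c : Chunk} :
    c ∈ o.candidates ↔ o.Unfinished c.1 ∧ c ∈ o.available c.1 := by
  classical
  rw [Observation.candidates, Finset.mem_biUnion]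
  constructor
  · rintro ⟨i, hi, hc⟩
    have := fst_of_mem_available hc
    subst this
    exact ⟨(Finset.mem_filter.1 hi).2, hc⟩
  · rintro ⟨h, hc⟩
    refine ⟨c.1, Finset.mem_filter.2 ⟨?_, h⟩, hc⟩
    obtain ⟨r, hr, -⟩ := h
    exact Finset.mem_range.2 (List.getElem?_eq_some_iff.1 hr).1

/-- Chunks are ordered by the number of remaining chunks of their request. -/
def Observation.key (o : Observation) (c : Chunk) : ℕ ×ₗ (ℕ ×ₗ ℕ) :=
  toLex (o.remaining c.1, toLex c)

lemma Observation.key_injective (o : Observation) : Function.Injective o.key := by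
  intro c c' h
  have := congrArg (fun p => ofLex (ofLex p).2) h
  exact this

/-- The number of candidates that precede chunk `c`. -/
noncomputable def Observation.rank (o : Observation) (c : Chunk) : ℕ :=
  (o.candidates.filter fun c' => o.key c' < o.key c).card

/-- The first `L` candidates. -/
noncomputable def Observation.firstCandidates (L : ℕ) (o : Observation) : Finset Chunk :=
  o.candidates.filter fun c => o.rank c < L

variable {L : ℕ} {o : Observation}

lemma Observation.rank_lt {c c' : Chunk} (hc : c ∈ o.candidates) (h : o.key c < o.key c') :
    o.rank c < o.rank c' := by
  refine Finset.card_lt_card (Finset.ssubset_iff_subset_ne.2 ⟨fun z hz => Finset.mem_filter.2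
    ⟨(Finset.mem_filter.1 hz).1, (Finset.mem_filter.1 hz).2.trans h⟩, fun heq => ?_⟩)
  have : c ∈ o.candidates.filter fun z => o.key z < o.key c :=
    heq ▸ Finset.mem_filter.2 ⟨hc, h⟩
  exact lt_irrefl _ (Finset.mem_filter.1 this).2

lemma Observation.mem_firstCandidates_of_key_lt {c c' : Chunk} (hc : c ∈ o.candidates)
    (hc' : c' ∈ o.firstCandidates L) (h : o.key c < o.key c') : c ∈ o.firstCandidates L :=
  Finset.mem_filter.2 ⟨hc, (rank_lt hc h).trans (Finset.mem_filter.1 hc').2⟩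

lemma Observation.card_firstCandidates_le : (o.firstCandidates L).card ≤ L := by
  conv_rhs => rw [← Finset.card_range L]
  refine Finset.card_le_card_of_injOn o.rank (fun c hc => ?_) fun c hc c' hc' h => ?_
  · simpa using (Finset.mem_filter.1 hc).2
  · have hm := (Finset.mem_filter.1 hc).1
    have hm' := (Finset.mem_filter.1 hc').1
    rcases lt_trichotomy (o.key c) (o.key c') with hlt | heq | hlt
    · exact absurd h (rank_lt hm hlt).ne
    · exact o.key_injective heq
    · exact absurd h (rank_lt hm' hlt).ne'

/-- Candidates preceding the smallest one left out are all chosen, so its rank is at most the number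
chosen; if that is below L, it should have been chosen too. -/
lemma Observation.firstCandidates_eq_of_card_lt (h : (o.firstCandidates L).card < L) :
    o.firstCandidates L = o.candidates := by
  refine Finset.Subset.antisymm (Finset.filter_subset _ _) ?_
  by_contra hns
  obtain ⟨c₀, hc₀, hc₀'⟩ := Finset.not_subset.1 hns
  obtain ⟨c, hc, hmin⟩ := Finset.exists_min_image (o.candidates \ o.firstCandidates L) o.key
    ⟨c₀, Finset.mem_sdiff.2 ⟨hc₀, hc₀'⟩⟩
  rw [Finset.mem_sdiff] at hc
  refine hc.2 (Finset.mem_filter.2 ⟨hc.1, lt_of_le_of_lt (Finset.card_le_card fun z hz => ?_) h⟩)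
  rw [Finset.mem_filter] at hz
  by_contra hz'
  exact absurd (hmin z (Finset.mem_sdiff.2 ⟨hz.1, hz'⟩)) (not_le.2 hz.2)

/-- The choice ignores the clock and the completion instants, which makes measurability of the
policy trivial. -/
lemma Observation.firstCandidates_congr {o o' : Observation} (h : o.arrived = o'.arrived)
    (h' : downloaded o.log = downloaded o'.log) :
    o.firstCandidates L = o'.firstCandidates L := by
  have h1 : o.Unfinished = o'.Unfinished := by
    ext i; simp only [Observation.Unfinished, numDownloaded, h, h']
  have h2 : o.remaining = o'.remaining := by
    ext i; simp only [Observation.remaining, numDownloaded, h, h']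
  have h3 : o.available = o'.available := by
    ext1 i; simp only [Observation.available, h, h']
  have hc : o.candidates = o'.candidates := by
    ext c
    rw [mem_candidates, mem_candidates, h1, h3]
  have hk : o.key = o'.key := by
    ext1 c
    rw [key, key, h2]
  have hr : o.rank = o'.rank := by
    ext c
    rw [rank, rank, hc, hk]
  rw [firstCandidates, firstCandidates, hc, hr]

lemma Observation.available_subset_candidates {i : ℕ} (hi : o.Unfinished i) :
    o.available i ⊆ o.candidates := by
  intro c hc
  have := fst_of_mem_available hc
  subst this
  exact mem_candidates.2 ⟨hi, hc⟩

/-- The SERPT-R policy that breaks ties by the numbers of the requests and the chunks. -/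
noncomputable def serptR (L : ℕ) : OnlinePolicy L where
  serve _ o := o.firstCandidates L
  card_le _ _ := Observation.card_firstCandidates_le
  feasible _ _ c hc := Observation.mem_candidates.1 (Finset.mem_filter.1 hc).1
  measurable_serve arr cs A := by
    have : ∀ p : unitInterval × (Fin cs.length → ℝ) × ℝ, Observation.firstCandidates L
        ⟨arr, List.ofFn (fun j => (p.2.1 j, cs.get j)), p.2.2⟩
        = Observation.firstCandidates L ⟨arr, cs.map fun c => (0, c), 0⟩ := by
      intro p
      refine Observation.firstCandidates_congr rfl ?_
      rw [downloaded_eq, downloaded_eq]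
      congr 1
      simp [List.map_ofFn, Function.comp_def]
    simp only [this]
    exact MeasurableSet.const _

lemma serptR_isSERPTR (L : ℕ) : (serptR L).IsSERPTR where
  no_idle _ o h i hi := by
    have h' := Observation.firstCandidates_eq_of_card_lt h
    exact (Observation.available_subset_candidates hi).trans h'.symm.subset
  priority _ o c hc i hi hlt c' hc' := by
    refine Observation.mem_firstCandidates_of_key_lt
      (Observation.available_subset_candidates hi hc') hc ?_
    rw [Observation.key, Observation.key, Observation.fst_of_mem_available hc', Prod.Lex.lt_iff]
    exact Or.inl hlt
  one_by_one _ o := by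
    -- Between requests with equally many remaining chunks, all available chunks of the one with the
    -- smaller number come first in the order.
    have key : ∀ c ∈ o.firstCandidates L, ∀ c' ∈ o.firstCandidates L, c.1 < c'.1 →
        o.remaining c.1 = o.remaining c'.1 → o.available c.1 ⊆ o.firstCandidates L := by
      intro c hc c' hc' hlt heq z hz
      have hi := (Observation.mem_candidates.1 (Finset.mem_filter.1 hc).1).1
      refine Observation.mem_firstCandidates_of_key_lt
        (Observation.available_subset_candidates hi hz) hc' ?_
      rw [Observation.key, Observation.key, Observation.fst_of_mem_available hz, Prod.Lex.lt_iff]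
      refine Or.inr ⟨heq, ?_⟩
      rw [Prod.Lex.lt_iff]
      exact Or.inl ((Observation.fst_of_mem_available hz).trans_lt hlt)
    intro c hc c' hc' hne heq
    rcases lt_or_gt_of_ne hne with hlt | hlt
    · exact Or.inl (key c hc c' hc' hlt heq)
    · exact Or.inr (key c' hc' c hc hlt heq.symm)

end Existence

end CloudStorage

theorem theorem1 (L : ℕ) (hL : 0 < L) (μ : ℝ) (hμ : 0 < μ) :
    (∃ σ : CloudStorage.OnlinePolicy L, σ.IsSERPTR) ∧
    ∀ σ : CloudStorage.OnlinePolicy L, σ.IsSERPTR →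
      ∀ (N : ℕ∞) (req : ℕ → CloudStorage.Request), 0 < N →
        CloudStorage.IsRequestSequence req N → (L : ℕ∞) ≤ CloudStorage.minDist req N →
        ∀ π : CloudStorage.OnlinePolicy L,
          CloudStorage.averageFlowTime σ μ req N ≤ CloudStorage.averageFlowTime π μ req N :=
  ⟨⟨CloudStorage.serptR L, CloudStorage.serptR_isSERPTR L⟩, fun _ hσ _ req _ hreq hd π =>
    CloudStorage.averageFlowTime_le π req hμ hL hreq hd hσ⟩
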